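/- \textbf{Setting.} The language of urelement set theory has equality, a binary symbol $\in$ and a unary predicate $\mathscr{A}$ ("is an urelement"); $Set(x)$ means $\neg\mathscr{A}(x)$. The theory $\mathrm{ZFCU}_{\mathrm R}$ consists of: urelements have no members; Extensionality for sets; Foundation; Pairing; Union; Powerset; Infinity; the Separation scheme; the Replacement scheme $$\forall w,u\,\bigl(\forall x\in w\,\exists! y\,\varphi(x,y,u)\rightarrow\exists v\,\forall x\in w\,\exists y\in v\,\varphi(x,y,u)\bigr);$$ and AC (every set is well-orderable). The urelements need not form a set. \emph{Collection} is the scheme $$\forall w,u\,\bigl(\forall x\in w\,\exists y\,\varphi(x,y,u)\rightarrow\exists v\,\forall x\in w\,\exists y\in v\,\varphi(x,y,u)\bigr).$$ The following definitions are made inside $\mathrm{ZFCU}_{\mathrm R}$. Let $\mathbb P$ be a forcing poset, that is, a set with a partial order $\le$ and a largest element $1_{\mathbb P}$. Write $p\perp q$ if $p,q$ have no common lower bound in $\mathbb P$, and call $D\subseteq\mathbb P$ \emph{dense below} $p$ if every $q\le p$ has some $r\le q$ in $D$. \textbf{Names.} By recursion, $\dot x$ is a $\mathbb P$-name iff (i)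 $\dot x$ is a set of ordered pairs $\langle y,p\rangle$ where $p\in\mathbb P$ and $y$ is either a $\mathbb P$-name or an urelement, and (ii) whenever $\langle a,p\rangle,\langle y,q\rangle\in\dot x$ with $a$ an urelement and $a\ne y$, then $p\perp q$. $U^{\mathbb P}$ is the class of $\mathbb P$-names. \textbf{Forcing relation.} The forcing language has the relation symbols $\subseteq,=,\in,\mathscr{A},\overset{\mathscr{A}}{=}$ and a constant for each $\mathbb P$-name; formulas are built with $\neg,\wedge,\exists$. For $p\in\mathbb P$ and $\dot x_1,\dot x_2\in U^{\mathbb P}$ (with $q,r,r_1,r_2$ ranging over $\mathbb P$ and $a$ over urelements), define by recursion: \begin{enumerate} \item $p\Vdash\mathscr{A}(\dot x_1)$ iff $\{q:\exists\langle a,r\rangle\in\dot x_1\ (q\le r)\}$ is dense below $p$. \item $p\Vdash\dot x_1\overset{\mathscr{A}}{=}\dot x_2$ iff the set of those $q$ such that either there are $a,r_1,r_2$ with $\langle a,r_1\rangle\in\dot x_1$, $\langle a,r_2\rangle\in\dot x_2$ and $q\le r_1,r_2$, or $q\perp r$ for every $\langle a,r\rangle\in\dot x_1\cup\dot x_2$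 with $a$ an urelement, is dense below $p$. \item $p\Vdash\dot x_1\in\dot x_2$ iff $\{q:\exists\langle\dot y,r\rangle\in\dot x_2\ (\dot y\in U^{\mathbb P}\wedge q\le r\wedge q\Vdash\dot y=\dot x_1)\}$ is dense below $p$. \item $p\Vdash\dot x_1\subseteq\dot x_2$ iff $q\Vdash\dot y\in\dot x_2$ whenever $\dot y\in U^{\mathbb P}$, $\langle\dot y,r\rangle\in\dot x_1$ and $q\le p,r$. \item $p\Vdash\dot x_1=\dot x_2$ iff $p\Vdash\dot x_1\subseteq\dot x_2$, $p\Vdash\dot x_2\subseteq\dot x_1$ and $p\Vdash\dot x_1\overset{\mathscr{A}}{=}\dot x_2$. \item $p\Vdash\neg\varphi$ iff there is no $q\le p$ with $q\Vdash\varphi$. \item $p\Vdash\varphi\wedge\psi$ iff $p\Vdash\varphi$ and $p\Vdash\psi$. \item $p\Vdash\exists x\,\varphi$ iff $\{q:\exists\dot z\in U^{\mathbb P}\ q\Vdash\varphi(\dot z)\}$ is dense below $p$. \end{enumerate} The forcing relation of $\mathbb P$ is \emph{full} if, for every formula $\varphi$ of the language, all $\dot x_1,\dots,\dot x_n\in U^{\mathbb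 P}$ and every $p\in\mathbb P$: whenever $p\Vdash\exists y\,\varphi(y,\dot x_1,\dots,\dot x_n)$, there is $\dot y\in U^{\mathbb P}$ with $p\Vdash\varphi(\dot y,\dot x_1,\dots,\dot x_n)$. The \emph{Fullness Principle} is the scheme that for every forcing poset $\mathbb P$ the forcing relation of $\mathbb P$ is full. \textbf{Theorem.} Over $\mathrm{ZFCU}_{\mathrm R}$, Collection and the Fullness Principle are equivalent: in every (not necessarily well-founded) model of $\mathrm{ZFCU}_{\mathrm R}$, all instances of Collection hold if and only if all instances of the Fullness Principle hold. -/

import Mathlib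

namespace Urelement

/-! ## The language of urelement set theory and the axioms -/

/-- The non-logical symbols of urelement set theory: a unary predicate for being an urelement
and the binary membership symbol (equality is a logical symbol). -/
inductive UrRel : ℕ → Type
  | ur : UrRel 1
  | mem : UrRel 2

/-- The first-order language of urelement set theory. -/
def urLang : FirstOrder.Language.{0, 0} := ⟨fun _ => Empty, UrRel⟩

section Axioms

variable {M : Type*} [urLang.Structure M]

/-- `x` is an urelement of the structure `M`. -/
def Ur (x : M) : Prop :=
  FirstOrder.Language.Structure.RelMap (L := urLang) (M := M) (n := 1) UrRel.ur ![x]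

/-- `x` is a member of `y` in the structure `M`. -/
def Mem (x y : M) : Prop :=
  FirstOrder.Language.Structure.RelMap (L := urLang) (M := M) (n := 2) UrRel.mem ![x, y]

infix:50 " ∈ᵘ " => Mem

/-- `x` is a set, i.e. not an urelement. -/
def IsSet (x : M) : Prop := ¬ Ur x

/-- `z = {a, b}`. -/
def IsUPair (z a b : M) : Prop := ∀ v, v ∈ᵘ z ↔ v = a ∨ v = b

/-- `z = ⟨a, b⟩ = {{a}, {a, b}}`. -/
def IsOPair (z a b : M) : Prop := ∃ s d, IsUPair s a a ∧ IsUPair d a b ∧ IsUPair z s d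

/-- `⟨a, b⟩ ∈ x`. -/
def PairMem (a b x : M) : Prop := ∃ z, IsOPair z a b ∧ z ∈ᵘ x

/-- `⟨a, ⟨b, c⟩⟩ ∈ x`. -/
def TripleMem (a b c x : M) : Prop := ∃ z, IsOPair z b c ∧ PairMem a z x

/-- The set `r` of ordered pairs is a strict well-ordering of the members of `x`. -/
def WellOrders (r x : M) : Prop :=
  (∀ a, a ∈ᵘ x → ¬ PairMem a a r) ∧
  (∀ a b c, a ∈ᵘ x → b ∈ᵘ x → c ∈ᵘ x → PairMem a b r → PairMem b c r → PairMem a c r) ∧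
  (∀ a b, a ∈ᵘ x → b ∈ᵘ x → a = b ∨ PairMem a b r ∨ PairMem b a r) ∧
  (∀ s, (∀ a, a ∈ᵘ s → a ∈ᵘ x) → (∃ a, a ∈ᵘ s) →
    ∃ m, m ∈ᵘ s ∧ ∀ a, a ∈ᵘ s → a ≠ m → PairMem m a r)

variable (M)

/-- `M` satisfies ZU. The parameters of the scheme are a finite tuple `u`. -/
structure ModelsZU : Prop where
  axiomUr : ∀ x : M, Ur x → ¬ ∃ y, y ∈ᵘ x
  extensionality : ∀ x y : M, IsSet x → IsSet y → (∀ z, z ∈ᵘ y ↔ z ∈ᵘ x) → x = y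
  foundation : ∀ x : M, (∃ y, y ∈ᵘ x) → ∃ z, z ∈ᵘ x ∧ ¬ ∃ v, v ∈ᵘ z ∧ v ∈ᵘ x
  pairing : ∀ x y : M, ∃ z, ∀ v, v ∈ᵘ z ↔ v = x ∨ v = y
  union : ∀ x : M, ∃ y, ∀ z, z ∈ᵘ y ↔ ∃ w, w ∈ᵘ x ∧ z ∈ᵘ w
  powerset : ∀ x : M, ∃ y, ∀ z, z ∈ᵘ y ↔ IsSet z ∧ ∀ v, v ∈ᵘ z → v ∈ᵘ x
  separation : ∀ (n : ℕ) (φ : urLang.Formula (Fin n ⊕ Fin 1)) (u : Fin n → M) (x : M),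
    ∃ y, ∀ z, z ∈ᵘ y ↔ z ∈ᵘ x ∧ φ.Realize (Sum.elim u ![z])
  infinity : ∃ s : M, (∃ y, y ∈ᵘ s ∧ IsSet y ∧ ∀ z, ¬ z ∈ᵘ y) ∧
    ∀ x, x ∈ᵘ s → ∃ y, y ∈ᵘ s ∧ ∀ z, z ∈ᵘ y ↔ z ∈ᵘ x ∨ z = x

/-- `M` satisfies every instance of Replacement. -/
def Replacement : Prop :=
  ∀ (n : ℕ) (φ : urLang.Formula (Fin n ⊕ Fin 2)) (u : Fin n → M) (w : M),
    (∀ x, x ∈ᵘ w → ∃! y, φ.Realize (Sum.elim u ![x, y])) →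
      ∃ v, ∀ x, x ∈ᵘ w → ∃ y, y ∈ᵘ v ∧ φ.Realize (Sum.elim u ![x, y])

/-- `M` satisfies every instance of Collection. -/
def Collection : Prop :=
  ∀ (n : ℕ) (φ : urLang.Formula (Fin n ⊕ Fin 2)) (u : Fin n → M) (w : M),
    (∀ x, x ∈ᵘ w → ∃ y, φ.Realize (Sum.elim u ![x, y])) →
      ∃ v, ∀ x, x ∈ᵘ w → ∃ y, y ∈ᵘ v ∧ φ.Realize (Sum.elim u ![x, y])

/-- `M` satisfies the axiom of choice: every set is well-orderable. -/
def AC : Prop := ∀ x : M, IsSet x → ∃ r, WellOrders r x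

/-- `M` is a model of ZFCU with Replacement (and not necessarily Collection). -/
structure ModelsZFCUR : Prop where
  zu : ModelsZU M
  replacement : Replacement M
  ac : AC M

end Axioms

/-! ## Forcing posets and names, inside a structure `M` -/

/-- A forcing poset of `M`: a set `carrier` of `M`, a set `rel` of `M` that is a partial order
on it in the sense of `M`, and a largest element. -/
structure ForcingPoset (M : Type*) [urLang.Structure M] where
  carrier : M
  rel : M
  one : M
  rel_sub : ∀ z, z ∈ᵘ rel → ∃ p q, p ∈ᵘ carrier ∧ q ∈ᵘ carrier ∧ IsOPair z p q
  refl : ∀ p, p ∈ᵘ carrier → PairMem p p rel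
  antisymm : ∀ p q, p ∈ᵘ carrier → q ∈ᵘ carrier → PairMem p q rel → PairMem q p rel → p = q
  trans : ∀ p q r, p ∈ᵘ carrier → q ∈ᵘ carrier → r ∈ᵘ carrier →
    PairMem p q rel → PairMem q r rel → PairMem p r rel
  one_mem : one ∈ᵘ carrier
  le_one : ∀ p, p ∈ᵘ carrier → PairMem p one rel

namespace ForcingPoset

variable {M : Type*} [urLang.Structure M] (ℙ : ForcingPoset M)

/-- `p` is a condition. -/
def Cond (p : M) : Prop := p ∈ᵘ ℙ.carrier

/-- `p ≤ q` in the forcing poset; this entails that `p` and `q` are conditions. -/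
def Le (p q : M) : Prop := ℙ.Cond p ∧ ℙ.Cond q ∧ PairMem p q ℙ.rel

/-- `p ⊥ q`. -/
def Incompatible (p q : M) : Prop := ¬ ∃ r, ℙ.Le r p ∧ ℙ.Le r q

/-- The class `D` of conditions is dense below `p`. -/
def DenseBelow (D : M → Prop) (p : M) : Prop := ∀ q, ℙ.Le q p → ∃ r, ℙ.Le r q ∧ D r

/-- The defining clause of a name, where the names already available are the members of `t`:
`x` is a set of ordered pairs `⟨y, p⟩` with `p` a condition and `y` in `t` or an urelement, and
whenever `⟨a, p⟩` and `⟨y, q⟩` are in `x`, `a` is an urelement and `a ≠ y`, then `p ⊥ q`. -/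
def NameClause (t x : M) : Prop :=
  IsSet x ∧
  (∀ z, z ∈ᵘ x → ∃ y p, IsOPair z y p ∧ ℙ.Cond p ∧ (y ∈ᵘ t ∨ Ur y)) ∧
  (∀ a y p q, Ur a → PairMem a p x → PairMem y q x → a ≠ y → ℙ.Incompatible p q)

/-- `x` is a name. The recursive definition is carried out inside `M`: `x` lies in some set `t` of
`M` all of whose members satisfy the defining clause relative to `t`. By Foundation in `M` this is
the unique class of `M` that obeys the recursion. -/
def IsName (x : M) : Prop := ∃ t, x ∈ᵘ t ∧ ∀ y, y ∈ᵘ t → ℙ.NameClause t y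

/-! ## The forcing relation -/

/-- `p ⊩ 𝒜(x)`. -/
def ForcesUr (p x : M) : Prop :=
  ℙ.DenseBelow (fun q => ∃ a r, Ur a ∧ PairMem a r x ∧ ℙ.Le q r) p

/-- `p ⊩ x =^𝒜 y`. -/
def ForcesUrEq (p x y : M) : Prop :=
  ℙ.DenseBelow (fun q =>
    (∃ a r₁ r₂, Ur a ∧ PairMem a r₁ x ∧ PairMem a r₂ y ∧ ℙ.Le q r₁ ∧ ℙ.Le q r₂) ∨
    ((∀ a r, Ur a → PairMem a r x → ℙ.Incompatible q r) ∧
      (∀ a r, Ur a → PairMem a r y → ℙ.Incompatible q r))) p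

/-- The clause for `p ⊩ x ∈ y`, where `E q z x` stands for `q ⊩ z = x`. -/
def MemClause (E : M → M → M → Prop) (p x y : M) : Prop :=
  ℙ.DenseBelow (fun q => ∃ z r, ℙ.IsName z ∧ PairMem z r y ∧ ℙ.Le q r ∧ E q z x) p

/-- The clause for `p ⊩ x ⊆ y`, where `E q z x` stands for `q ⊩ z = x`. -/
def SubClause (E : M → M → M → Prop) (p x y : M) : Prop :=
  ∀ z r q, ℙ.IsName z → PairMem z r x → ℙ.Le q p → ℙ.Le q r → ℙ.MemClause E q z y

/-- The clause for `p ⊩ x = y`, where `E q z x` stands for `q ⊩ z = x` at earlier stages. -/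
def EqClause (E : M → M → M → Prop) (p x y : M) : Prop :=
  ℙ.SubClause E p x y ∧ ℙ.SubClause E p y x ∧ ℙ.ForcesUrEq p x y

/-- `e` is (a set of `M` that codes) a solution of the recursion for `p ⊩ x = y` on the names in
the set `t` of `M`, where `t` contains every name occurring in a member of `t`. -/
def IsEqTable (t e : M) : Prop :=
  (∀ x, x ∈ᵘ t → ℙ.IsName x) ∧
  (∀ x y r, x ∈ᵘ t → ℙ.IsName y → PairMem y r x → y ∈ᵘ t) ∧
  (∀ p x y, ℙ.Cond p → x ∈ᵘ t → y ∈ᵘ t →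
    (TripleMem p x y e ↔ ℙ.EqClause (fun q v w => TripleMem q v w e) p x y))

/-- `p ⊩ x = y`, by recursion inside `M`: some solution of the recursion that is a set of `M` and
is defined at `x` and `y` says so. -/
def ForcesEq (p x y : M) : Prop :=
  ∃ t e, ℙ.IsEqTable t e ∧ x ∈ᵘ t ∧ y ∈ᵘ t ∧ TripleMem p x y e

/-- `p ⊩ x ∈ y`. -/
def ForcesMem (p x y : M) : Prop := ℙ.MemClause ℙ.ForcesEq p x y

/-- `p ⊩ x ⊆ y`. -/
def ForcesSub (p x y : M) : Prop := ℙ.SubClause ℙ.ForcesEq p x y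

end ForcingPoset

/-- Formulas of the forcing language with free variables among `v₀, …, vₙ₋₁`. The constants of the
language (the names) are supplied as values of the free variables; `ex φ` binds the last variable
of `φ`. -/
inductive ForcingFormula : ℕ → Type
  | ur {n : ℕ} (i : Fin n) : ForcingFormula n
  | urEq {n : ℕ} (i j : Fin n) : ForcingFormula n
  | mem {n : ℕ} (i j : Fin n) : ForcingFormula n
  | sub {n : ℕ} (i j : Fin n) : ForcingFormula n
  | eq {n : ℕ} (i j : Fin n) : ForcingFormula n
  | neg {n : ℕ} (φ : ForcingFormula n) : ForcingFormula n
  | and {n : ℕ} (φ ψ : ForcingFormula n) : ForcingFormula n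
  | ex {n : ℕ} (φ : ForcingFormula (n + 1)) : ForcingFormula n

namespace ForcingPoset

variable {M : Type*} [urLang.Structure M] (ℙ : ForcingPoset M)

/-- `p ⊩ φ(x₀, …, xₙ₋₁)`. -/
def Forces : {n : ℕ} → ForcingFormula n → (Fin n → M) → M → Prop
  | _, .ur i, x, p => ℙ.ForcesUr p (x i)
  | _, .urEq i j, x, p => ℙ.ForcesUrEq p (x i) (x j)
  | _, .mem i j, x, p => ℙ.ForcesMem p (x i) (x j)
  | _, .sub i j, x, p => ℙ.ForcesSub p (x i) (x j)
  | _, .eq i j, x, p => ℙ.ForcesEq p (x i) (x j)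
  | _, .neg φ, x, p => ¬ ∃ q, ℙ.Le q p ∧ Forces φ x q
  | _, .and φ ψ, x, p => Forces φ x p ∧ Forces ψ x p
  | _, .ex φ, x, p =>
      ℙ.DenseBelow (fun q => ∃ z, ℙ.IsName z ∧ Forces φ (Fin.snoc (α := fun _ => M) x z) q) p

/-- The forcing relation is full: whenever `p ⊩ ∃ y φ(x₀, …, xₙ₋₁, y)`, there is a name `y` with
`p ⊩ φ(x₀, …, xₙ₋₁, y)`. -/
def IsFull : Prop :=
  ∀ (n : ℕ) (φ : ForcingFormula (n + 1)) (x : Fin n → M) (p : M),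
    (∀ i, ℙ.IsName (x i)) → ℙ.Cond p → ℙ.Forces (.ex φ) x p →
      ∃ y, ℙ.IsName y ∧ ℙ.Forces φ (Fin.snoc (α := fun _ => M) x y) p

end ForcingPoset

/-- The Fullness Principle holds in `M`: every forcing poset of `M` has a full forcing relation. -/
def FullnessPrinciple (M : Type*) [urLang.Structure M] : Prop :=
  ∀ ℙ : ForcingPoset M, ℙ.IsFull

end Urelement

/-! Collection gives Fullness by mixing. If p forces ∃y φ, Collection yields a set Z of names such
that every condition having a witness for φ has one in Z. Choice well-orders Z. Let r select z when
r forces φ(z) and no extension of r forces φ of an earlier member of Z. Conditions selecting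
different names are incompatible, so a single name y can be glued (`exists_mix`) that each r
selecting z forces to equal z. The selecting conditions are dense below p, hence p forces φ(y).
Clause (ii) for names survives the gluing because compatible conditions select the same z.

Fullness gives Collection by a poset that adds nothing. Given a nonempty w with ∀ x ∈ w ∃ y φ(x, y),
take the members of w as pairwise incomparable minimal conditions under a top element. Below a
minimal condition x everything is decided: each name is forced equal to the canonical name of a
unique element (`IsAtomCond.exists_value`), and forcing at x is truth in M (`forces_toForcing`).
Mixing, which needs no Collection here, gives a name X that each x ∈ w forces to be the canonical
name of x. The top forces ∃y φ(X, y), and Fullness supplies one name y for all x at once. Sending x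
to the value of y at x is a definable function, so Replacement makes its range a set, and this set
collects.

M may be ill-founded and its axioms are schemes. Hence recursions run inside M, and each class fed
to Separation or Replacement must be shown definable; `Dfn` and `DFun` leave most of that to
instance search. -/

namespace Urelement

open FirstOrder Language

/-! ### Definable classes and operations -/

section Definability

variable {M : Type*} [urLang.Structure M]

/-- The class of assignments `P` is first-order definable with parameters: the variables are
indexed by `ℕ`, and every element of `M` serves as a variable that denotes itself. -/
class Dfn (P : (ℕ → M) → Prop) : Prop where
  out : ∃ φ : urLang.Formula (M ⊕ ℕ), ∀ v, φ.Realize (Sum.elim id v) ↔ P v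

/-- The operation `f` on assignments has a definable graph. -/
class DFun (f : (ℕ → M) → M) : Prop where
  out : Dfn fun v => f (fun n => v (n + 1)) = v 0

theorem Dfn.congr {P Q : (ℕ → M) → Prop} (h : Dfn P) (hPQ : ∀ v, P v ↔ Q v) : Dfn Q := by
  obtain ⟨φ, hφ⟩ := h.out
  exact ⟨φ, fun v => (hφ v).trans (hPQ v)⟩

theorem Dfn.rename {P : (ℕ → M) → Prop} (h : Dfn P) (σ : ℕ → ℕ) :
    Dfn fun v => P (fun n => v (σ n)) := by
  obtain ⟨φ, hφ⟩ := h.out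
  refine ⟨φ.relabel (Sum.map id σ), fun v => ?_⟩
  rw [Formula.realize_relabel, ← hφ]
  have : Sum.elim id v ∘ Sum.map id σ = Sum.elim id (fun n => v (σ n)) := by
    funext x; cases x <;> rfl
  rw [this]

instance Dfn.not {P : (ℕ → M) → Prop} [h : Dfn P] : Dfn fun v => ¬ P v := by
  obtain ⟨φ, hφ⟩ := h.out
  exact ⟨φ.not, fun v => by rw [Formula.realize_not, hφ]⟩

instance Dfn.and {P Q : (ℕ → M) → Prop} [h : Dfn P] [h' : Dfn Q] : Dfn fun v => P v ∧ Q v := by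
  obtain ⟨φ, hφ⟩ := h.out
  obtain ⟨ψ, hψ⟩ := h'.out
  exact ⟨φ ⊓ ψ, fun v => by rw [Formula.realize_inf, hφ, hψ]⟩

instance Dfn.or {P Q : (ℕ → M) → Prop} [h : Dfn P] [h' : Dfn Q] : Dfn fun v => P v ∨ Q v := by
  obtain ⟨φ, hφ⟩ := h.out
  obtain ⟨ψ, hψ⟩ := h'.out
  exact ⟨φ ⊔ ψ, fun v => by rw [Formula.realize_sup, hφ, hψ]⟩

instance Dfn.imp {P Q : (ℕ → M) → Prop} [h : Dfn P] [h' : Dfn Q] : Dfn fun v => P v → Q v := by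
  obtain ⟨φ, hφ⟩ := h.out
  obtain ⟨ψ, hψ⟩ := h'.out
  exact ⟨φ.imp ψ, fun v => by rw [Formula.realize_imp, hφ, hψ]⟩

instance Dfn.iff {P Q : (ℕ → M) → Prop} [h : Dfn P] [h' : Dfn Q] : Dfn fun v => P v ↔ Q v := by
  obtain ⟨φ, hφ⟩ := h.out
  obtain ⟨ψ, hψ⟩ := h'.out
  exact ⟨φ.iff ψ, fun v => by rw [Formula.realize_iff, hφ, hψ]⟩

/-- Bound variables follow the de Bruijn convention: the quantified variable gets index 0 and the
old assignment moves up by one. -/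
instance Dfn.exists {P : (ℕ → M) → M → Prop} [h : Dfn fun v => P (fun n => v (n + 1)) (v 0)] :
    Dfn fun v => ∃ y, P v y := by
  obtain ⟨φ, hφ⟩ := h.out
  let σ : M ⊕ ℕ → (M ⊕ ℕ) ⊕ Fin 1 :=
    Sum.elim (fun c => .inl (.inl c)) (fun n => Nat.casesOn n (.inr 0) fun k => .inl (.inr k))
  refine ⟨(φ.relabel σ).iExs (Fin 1), fun v => ?_⟩
  rw [Formula.realize_iExs]
  have key : ∀ i : Fin 1 → M, Sum.elim (Sum.elim id v) i ∘ σ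
      = Sum.elim id (fun n => Nat.casesOn n (i 0) v) := by
    intro i
    funext x
    rcases x with c | n
    · rfl
    · cases n <;> rfl
  constructor
  · rintro ⟨i, hi⟩
    rw [Formula.realize_relabel, key, hφ] at hi
    exact ⟨i 0, hi⟩
  · rintro ⟨y, hy⟩
    refine ⟨fun _ => y, ?_⟩
    rw [Formula.realize_relabel, key, hφ]
    exact hy

instance Dfn.forall {P : (ℕ → M) → M → Prop} [h : Dfn fun v => P (fun n => v (n + 1)) (v 0)] :
    Dfn fun v => ∀ y, P v y :=
  (inferInstance : Dfn fun v => ¬ ∃ y, ¬ P v y).congr fun v => by push Not; rfl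

instance Dfn.const {p : Prop} : Dfn (M := M) fun _ => p := by
  by_cases h : p
  · exact ⟨⊤, fun v => by simp [h]⟩
  · exact ⟨⊥, fun v => by simp [h]⟩

instance DFun.var {i : ℕ} : DFun (M := M) fun v => v i :=
  ⟨⟨Term.equal (Term.var (Sum.inr (i + 1))) (Term.var (Sum.inr 0)), fun v => by
    simp [Formula.realize_equal]⟩⟩

instance DFun.const {c : M} : DFun fun _ : ℕ → M => c :=
  ⟨⟨Term.equal (Term.var (Sum.inl c)) (Term.var (Sum.inr 0)), fun v => by
    simp [Formula.realize_equal]⟩⟩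

/-- A definable operation is substituted by quantifying over its value. The `subst` lemmas iterate
this, so that a predicate need only be treated at plain variables. -/
theorem Dfn.exists_eq {P : (ℕ → M) → M → Prop} (h : Dfn fun v => P (fun n => v (n + 1)) (v 0))
    {f : (ℕ → M) → M} (hf : DFun f) : Dfn fun v => P v (f v) := by
  have := hf.out
  exact (inferInstance : Dfn fun v => ∃ y, f v = y ∧ P v y).congr fun v => by simp

theorem DFun.shift {f : (ℕ → M) → M} (h : DFun f) (k : ℕ) :
    DFun fun v => f (fun n => v (n + k)) :=
  ⟨(h.out.rename (fun n => Nat.casesOn n 0 fun m => m + k + 1)).congr fun v => by rfl⟩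

theorem Dfn.subst₁ {R : M → Prop} (h : Dfn fun v => R (v 0)) {f : (ℕ → M) → M}
    (hf : DFun f) : Dfn fun v => R (f v) :=
  Dfn.exists_eq (P := fun _ y => R y) h hf

theorem Dfn.subst₂ {R : M → M → Prop} (h : Dfn fun v => R (v 0) (v 1)) {f g : (ℕ → M) → M}
    (hf : DFun f) (hg : DFun g) : Dfn fun v => R (f v) (g v) :=
  Dfn.exists_eq (P := fun v y => R y (g v))
    (Dfn.exists_eq (P := fun v y => R (v 0) y)
      (h.rename (fun n => Nat.casesOn n 1 fun _ => 0)) (hg.shift 1)) hf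

theorem Dfn.subst₃ {R : M → M → M → Prop} (h : Dfn fun v => R (v 0) (v 1) (v 2))
    {f g k : (ℕ → M) → M} (hf : DFun f) (hg : DFun g) (hk : DFun k) :
    Dfn fun v => R (f v) (g v) (k v) :=
  Dfn.exists_eq (P := fun v y => R y (g v) (k v))
    (Dfn.exists_eq (P := fun v y => R (v 0) y (k fun n => v (n + 1)))
      (Dfn.exists_eq (P := fun v y => R (v 1) (v 0) y)
        (h.rename (fun n => Nat.casesOn n 2 fun m => Nat.casesOn m 1 fun _ => 0)) (hk.shift 2))
      (hg.shift 1)) hf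

theorem Dfn.subst₄ {R : M → M → M → M → Prop} (h : Dfn fun v => R (v 0) (v 1) (v 2) (v 3))
    {f g k l : (ℕ → M) → M} (hf : DFun f) (hg : DFun g) (hk : DFun k) (hl : DFun l) :
    Dfn fun v => R (f v) (g v) (k v) (l v) :=
  Dfn.exists_eq (P := fun v y => R y (g v) (k v) (l v))
    (Dfn.exists_eq (P := fun v y => R (v 0) y (k fun n => v (n + 1)) (l fun n => v (n + 1)))
      (Dfn.exists_eq (P := fun v y => R (v 1) (v 0) y (l fun n => v (n + 2)))
        (Dfn.exists_eq (P := fun v y => R (v 2) (v 1) (v 0) y)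
          (h.rename fun n => Nat.casesOn n 3 fun m => Nat.casesOn m 2 fun m =>
            Nat.casesOn m 1 fun _ => 0)
          (hl.shift 3)) (hk.shift 2))
      (hg.shift 1)) hf

instance Dfn.eq {f g : (ℕ → M) → M} [hf : DFun f] [hg : DFun g] : Dfn fun v => f v = g v :=
  Dfn.subst₂ (R := fun a b => a = b)
    ⟨Term.equal (Term.var (Sum.inr 0)) (Term.var (Sum.inr 1)), fun v => by
      simp [Formula.realize_equal]⟩ hf hg

instance Dfn.mem {f g : (ℕ → M) → M} [hf : DFun f] [hg : DFun g] : Dfn fun v => f v ∈ᵘ g v :=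
  Dfn.subst₂ (R := fun a b => a ∈ᵘ b)
    ⟨Relations.formula (L := urLang) (n := 2) UrRel.mem
      ![Term.var (Sum.inr 0), Term.var (Sum.inr 1)], fun v =>
      Formula.realize_rel.trans (iff_of_eq (congrArg _ (funext fun i => by
        fin_cases i <;> rfl)))⟩ hf hg

instance Dfn.ur {f : (ℕ → M) → M} [hf : DFun f] : Dfn fun v => Ur (f v) :=
  Dfn.subst₁ (R := Ur)
    ⟨Relations.formula (L := urLang) (n := 1) UrRel.ur ![Term.var (Sum.inr 0)], fun v =>
      Formula.realize_rel.trans (iff_of_eq (congrArg _ (funext fun i => by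
        fin_cases i; rfl)))⟩ hf

instance Dfn.isSet {f : (ℕ → M) → M} [hf : DFun f] : Dfn fun v => IsSet (f v) :=
  Dfn.subst₁ (R := IsSet) (by unfold IsSet; infer_instance) hf

instance Dfn.isUPair {f g k : (ℕ → M) → M} [hf : DFun f] [hg : DFun g] [hk : DFun k] :
    Dfn fun v => IsUPair (f v) (g v) (k v) :=
  Dfn.subst₃ (R := IsUPair) (by unfold IsUPair; infer_instance) hf hg hk

instance Dfn.isOPair {f g k : (ℕ → M) → M} [hf : DFun f] [hg : DFun g] [hk : DFun k] :
    Dfn fun v => IsOPair (f v) (g v) (k v) :=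
  Dfn.subst₃ (R := IsOPair) (by unfold IsOPair; infer_instance) hf hg hk

instance Dfn.pairMem {f g k : (ℕ → M) → M} [hf : DFun f] [hg : DFun g] [hk : DFun k] :
    Dfn fun v => PairMem (f v) (g v) (k v) :=
  Dfn.subst₃ (R := PairMem) (by unfold PairMem; infer_instance) hf hg hk

instance Dfn.tripleMem {f g k l : (ℕ → M) → M} [hf : DFun f] [hg : DFun g] [hk : DFun k]
    [hl : DFun l] : Dfn fun v => TripleMem (f v) (g v) (k v) (l v) :=
  Dfn.subst₄ (R := TripleMem) (by unfold TripleMem; infer_instance) hf hg hk hl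

/-- The axiom schemes take finitely many parameters. Only finitely many variables occur in a
formula: the constants among them become entries of the tuple `u`, and indices from `k` on receive
the default `d`. -/
theorem Dfn.formula (P : (ℕ → M) → Prop) [h : Dfn P] (k : ℕ) (d : M) :
    ∃ (n : ℕ) (φ : urLang.Formula (Fin n ⊕ Fin k)) (u : Fin n → M), ∀ v : Fin k → M,
      φ.Realize (Sum.elim u v) ↔ P (fun i => if h : i < k then v ⟨i, h⟩ else d) := by
  classical
  obtain ⟨φ, hφ⟩ := h.out
  let S := BoundedFormula.freeVarFinset φ
  let e := S.equivFin
  let σ : S → Fin S.card ⊕ Fin k := fun s =>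
    match s.1 with
    | .inl _ => .inl (e s)
    | .inr i => if h : i < k then .inr ⟨i, h⟩ else .inl (e s)
  refine ⟨S.card, BoundedFormula.restrictFreeVar φ σ,
    fun j => Sum.elim id (fun _ => d) (e.symm j).1, fun v => ?_⟩
  rw [← hφ]
  refine BoundedFormula.realize_restrictFreeVar (v' := _) ?_
  intro s
  obtain ⟨x, hx⟩ := s
  rcases x with c | i
  · simp [σ]
  · by_cases hi : i < k <;> simp [σ, hi]

end Definability

/-! ### Separation, Replacement and pairs for definable classes -/

section Comprehension

variable {M : Type*} [urLang.Structure M]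

/-- The class `P` is a set of `M`. -/
def Small (P : M → Prop) : Prop := ∃ x, IsSet x ∧ ∀ z, z ∈ᵘ x ↔ P z

theorem Small.congr {P Q : M → Prop} (h : Small P) (hPQ : ∀ z, P z ↔ Q z) : Small Q := by
  obtain rfl : P = Q := funext fun z => propext (hPQ z)
  exact h

variable [hM : Fact (ModelsZFCUR M)]

theorem IsSet.of_mem {x y : M} (h : x ∈ᵘ y) : IsSet y :=
  fun hy => hM.out.zu.axiomUr y hy ⟨x, h⟩

theorem IsSet.ext {x y : M} (hx : IsSet x) (hy : IsSet y) (h : ∀ z, z ∈ᵘ x ↔ z ∈ᵘ y) : x = y :=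
  hM.out.zu.extensionality x y hx hy fun z => (h z).symm

variable (M) in
theorem exists_empty : ∃ x : M, IsSet x ∧ ∀ z, ¬ z ∈ᵘ x := by
  obtain ⟨s, ⟨y, -, h⟩, -⟩ := hM.out.zu.infinity
  exact ⟨y, h⟩

variable (M) in
/-- The empty set of `M`. -/
noncomputable def empt : M := (exists_empty M).choose

theorem isSet_empt : IsSet (empt M) := (exists_empty M).choose_spec.1

theorem not_mem_empt (z : M) : ¬ z ∈ᵘ empt M := (exists_empty M).choose_spec.2 z

open Classical in
/-- `{z | P z}` if this is a set of `M`, and the empty set otherwise. -/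
noncomputable def cls (P : M → Prop) : M := if h : Small P then h.choose else empt M

theorem isSet_cls (P : M → Prop) : IsSet (cls P) := by
  unfold cls
  split_ifs with h
  · exact h.choose_spec.1
  · exact isSet_empt

theorem Small.mem_cls {P : M → Prop} (h : Small P) {z : M} : z ∈ᵘ cls P ↔ P z := by
  rw [cls, dif_pos h]
  exact h.choose_spec.2 z

/-- The right side is first-order over `P`, which is what makes `cls` a definable operation. -/
theorem cls_eq_iff {P : M → Prop} {y : M} :
    cls P = y ↔ (IsSet y ∧ ∀ z, z ∈ᵘ y ↔ P z) ∨
      (¬ ∃ x, IsSet x ∧ ∀ z, z ∈ᵘ x ↔ P z) ∧ y = empt M := by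
  by_cases h : Small P
  · have h' : ∃ x, IsSet x ∧ ∀ z, z ∈ᵘ x ↔ P z := h
    simp only [h', not_true_eq_false, false_and, or_false]
    constructor
    · rintro rfl
      exact ⟨isSet_cls P, fun z => h.mem_cls⟩
    · rintro ⟨hy, hz⟩
      exact (isSet_cls P).ext hy fun z => h.mem_cls.trans (hz z).symm
  · rw [cls, dif_neg h]
    constructor
    · rintro rfl
      exact .inr ⟨h, rfl⟩
    · rintro (h' | h')
      · exact absurd ⟨y, h'⟩ h
      · exact h'.2.symm

theorem cls_congr {P Q : M → Prop} (h : ∀ z, P z ↔ Q z) : cls P = cls Q :=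
  congrArg cls (funext fun z => propext (h z))

instance DFun.cls {Q : (ℕ → M) → M → Prop} [h : Dfn fun v => Q (fun n => v (n + 1)) (v 0)] :
    DFun fun v => cls fun z => Q v z := by
  have h2 : Dfn fun v : ℕ → M => Q (fun n => v (n + 2)) (v 0) :=
    h.rename fun n => Nat.casesOn n 0 fun m => m + 2
  have h3 : Dfn fun v : ℕ → M => Q (fun n => v (n + 3)) (v 0) :=
    h.rename fun n => Nat.casesOn n 0 fun m => m + 3
  exact ⟨(inferInstance : Dfn fun v : ℕ → M =>
    (IsSet (v 0) ∧ ∀ z, z ∈ᵘ v 0 ↔ Q (fun n => v (n + 1)) z) ∨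
      (¬ ∃ x, IsSet x ∧ ∀ z, z ∈ᵘ x ↔ Q (fun n => v (n + 1)) z) ∧ v 0 = empt M).congr
    fun v => cls_eq_iff.symm⟩

open Classical in
/-- The unique `y` with `P y` if there is one, and the empty set otherwise. -/
noncomputable def the (P : M → Prop) : M := if h : ∃! y, P y then h.choose else empt M

theorem the_eq {P : M → Prop} {y : M} (hy : P y) (h : ∀ z, P z → z = y) : the P = y := by
  have h' : ∃! y, P y := ⟨y, hy, h⟩
  rw [the, dif_pos h']
  exact h _ h'.choose_spec.1

instance DFun.the {Q : (ℕ → M) → M → Prop} [h : Dfn fun v => Q (fun n => v (n + 1)) (v 0)] :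
    DFun fun v => the fun z => Q v z := by
  have h1 : Dfn fun v : ℕ → M => Q (fun n => v (n + 1)) (v 0) := h
  have h2 : Dfn fun v : ℕ → M => Q (fun n => v (n + 2)) (v 0) :=
    h.rename fun n => Nat.casesOn n 0 fun m => m + 2
  have h3 : Dfn fun v : ℕ → M => Q (fun n => v (n + 3)) (v 0) :=
    h.rename fun n => Nat.casesOn n 0 fun m => m + 3
  have h4 : Dfn fun v : ℕ → M => Q (fun n => v (n + 3)) (v 1) :=
    h.rename fun n => Nat.casesOn n 1 fun m => m + 3
  refine ⟨(inferInstance : Dfn fun v : ℕ → M =>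
    (Q (fun n => v (n + 1)) (v 0) ∧ ∀ z, Q (fun n => v (n + 1)) z → z = v 0) ∨
      (¬ ∃ y, Q (fun n => v (n + 1)) y ∧ ∀ z, Q (fun n => v (n + 1)) z → z = y) ∧
        v 0 = empt M).congr fun v => ?_⟩
  by_cases hu : ∃! y, Q (fun n => v (n + 1)) y
  · have hu' : ∃ y, Q (fun n => v (n + 1)) y ∧ ∀ z, Q (fun n => v (n + 1)) z → z = y := hu
    simp only [hu', not_true_eq_false, false_and, or_false]
    constructor
    · rintro ⟨hy, hz⟩
      exact the_eq hy hz
    · obtain ⟨y, hy, hz⟩ := hu'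
      rw [the_eq hy hz]
      rintro rfl
      exact ⟨hy, hz⟩
  · rw [Urelement.the, dif_neg hu]
    constructor
    · rintro (h' | h')
      · exact absurd ⟨_, h'⟩ hu
      · exact h'.2.symm
    · intro h'
      exact .inr ⟨hu, h'.symm⟩

theorem Small.of_forall_iff {P : M → Prop} {x : M} (h : ∀ z, z ∈ᵘ x ↔ P z) : Small P := by
  by_cases hx : IsSet x
  · exact ⟨x, hx, h⟩
  · refine ⟨empt M, isSet_empt, fun z => ?_⟩
    rw [← h]
    exact iff_of_false (not_mem_empt z) fun hz => hx (.of_mem hz)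

theorem Small.sep (x : M) (P : M → Prop) [Dfn fun v => P (v 0)] : Small fun z => z ∈ᵘ x ∧ P z := by
  obtain ⟨n, φ, u, h⟩ := Dfn.formula (fun v : ℕ → M => P (v 0)) 1 x
  obtain ⟨y, hy⟩ := hM.out.zu.separation n φ u x
  refine .of_forall_iff (x := y) fun z => ?_
  rw [hy, h]
  rfl

theorem Small.of_subset {P : M → Prop} [Dfn fun v => P (v 0)] (x : M) (h : ∀ z, P z → z ∈ᵘ x) :
    Small P := by
  obtain ⟨y, hy, hz⟩ := Small.sep x P
  exact ⟨y, hy, fun z => (hz z).trans ⟨And.right, fun hP => ⟨h z hP, hP⟩⟩⟩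

theorem Small.upair (a b : M) : Small fun z => z = a ∨ z = b :=
  .of_forall_iff (hM.out.zu.pairing a b).choose_spec

theorem Small.sUnion (x : M) : Small fun z => ∃ w, w ∈ᵘ x ∧ z ∈ᵘ w :=
  .of_forall_iff (hM.out.zu.union x).choose_spec

theorem Small.mem (x : M) : Small fun z => z ∈ᵘ x := .of_forall_iff fun _ => .rfl

theorem Small.or {P Q : M → Prop} (hP : Small P) (hQ : Small Q) : Small fun z => P z ∨ Q z := by
  obtain ⟨x, -, hx⟩ := hP
  obtain ⟨y, -, hy⟩ := hQ
  obtain ⟨p, -, hp⟩ := Small.upair x y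
  refine (Small.sUnion p).congr fun z => ?_
  simp [hp, hx, hy]

theorem Small.singleton (a : M) : Small fun z => z = a :=
  (Small.upair a a).congr fun _ => or_self_iff

theorem Small.image_rel (w : M) (R : M → M → Prop) [hR : Dfn fun v => R (v 0) (v 1)]
    (h : ∀ x, x ∈ᵘ w → ∀ y y', R x y → R x y' → y = y') :
    Small fun y => ∃ x, x ∈ᵘ w ∧ R x y := by
  have := hR.rename fun n => Nat.casesOn n 1 fun _ => 0
  -- Replacement asks for a total function, so `w` is first cut down to the domain of `R`.
  obtain ⟨w', -, hw'⟩ := Small.sep w fun x => ∃ y, R x y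
  obtain ⟨n, φ, u, hφ⟩ := Dfn.formula (fun v : ℕ → M => R (v 0) (v 1)) 2 w
  obtain ⟨v, hv⟩ := hM.out.replacement n φ u w' (fun x hx => by
    obtain ⟨hxw, y, hy⟩ := (hw' x).1 hx
    exact ⟨y, (hφ _).2 hy, fun y' hy' => h x hxw y' y ((hφ _).1 hy') hy⟩)
  have := hR.rename fun n => Nat.casesOn n 0 fun _ => 1
  -- Replacement only provides a superset of the range; Separation trims it.
  refine .of_subset v ?_
  rintro y ⟨x, hx, hxy⟩
  obtain ⟨y', hy', hxy'⟩ := hv x ((hw' x).2 ⟨hx, y, hxy⟩)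
  rwa [h x hx y y' hxy ((hφ _).1 hxy')]

theorem Small.image (w : M) (F : M → M) [hF : DFun fun v => F (v 0)] :
    Small fun y => ∃ x, x ∈ᵘ w ∧ y = F x := by
  have : Dfn fun v => v 1 = F (v 0) :=
    Dfn.eq (hf := DFun.var) (hg := hF)
  exact .image_rel w (fun x y => y = F x) fun x _ y y' h h' => h.trans h'.symm

theorem Small.biUnion (w : M) (P : M → M → Prop) [hP : Dfn fun v => P (v 0) (v 1)]
    (h : ∀ x, x ∈ᵘ w → Small (P x)) : Small fun z => ∃ x, x ∈ᵘ w ∧ P x z := by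
  have : Dfn fun v => P (v 1) (v 0) := hP.rename fun n => Nat.casesOn n 1 fun _ => 0
  obtain ⟨u, -, hu⟩ := Small.image w fun x => cls fun z => P x z
  refine (Small.sUnion u).congr fun z => ?_
  constructor
  · rintro ⟨y, hy, hz⟩
    obtain ⟨x, hx, rfl⟩ := (hu y).1 hy
    exact ⟨x, hx, (h x hx).mem_cls.1 hz⟩
  · rintro ⟨x, hx, hz⟩
    exact ⟨_, (hu _).2 ⟨x, hx, rfl⟩, (h x hx).mem_cls.2 hz⟩

/-! ### Pairs -/

/-- The unordered pair `{a, b}`. -/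
noncomputable def upair (a b : M) : M := cls fun z => z = a ∨ z = b

theorem mem_upair {a b z : M} : z ∈ᵘ upair a b ↔ z = a ∨ z = b := (Small.upair a b).mem_cls

theorem isUPair_iff {z a b : M} : IsUPair z a b ↔ z = upair a b := by
  constructor
  · intro h
    exact (IsSet.of_mem ((h a).2 (.inl rfl))).ext (isSet_cls _) fun v =>
      (h v).trans mem_upair.symm
  · rintro rfl v
    exact mem_upair

/-- The ordered pair `⟨a, b⟩`. -/
noncomputable def opair (a b : M) : M := upair (upair a a) (upair a b)

theorem isOPair_iff {z a b : M} : IsOPair z a b ↔ z = opair a b := by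
  simp [IsOPair, isUPair_iff, opair]

theorem pairMem_iff {a b x : M} : PairMem a b x ↔ opair a b ∈ᵘ x := by
  simp [PairMem, isOPair_iff]

theorem tripleMem_iff {a b c x : M} : TripleMem a b c x ↔ opair a (opair b c) ∈ᵘ x := by
  simp [TripleMem, isOPair_iff, pairMem_iff]

theorem upair_inj {a b c : M} (h : upair a b = upair a c) : b = c := by
  have h1 : b ∈ᵘ upair a c := h ▸ mem_upair.2 (.inr rfl)
  have h2 : c ∈ᵘ upair a b := h ▸ mem_upair.2 (.inr rfl)
  rw [mem_upair] at h1 h2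
  rcases h1 with rfl | rfl
  · rcases h2 with rfl | rfl <;> rfl
  · rfl

theorem upair_self_eq {a b c : M} (h : upair a a = upair b c) : b = a ∧ c = a := by
  have h1 : b ∈ᵘ upair a a := h ▸ mem_upair.2 (.inl rfl)
  have h2 : c ∈ᵘ upair a a := h ▸ mem_upair.2 (.inr rfl)
  rw [mem_upair, or_self_iff] at h1 h2
  exact ⟨h1, h2⟩

theorem opair_inj {a b c d : M} : opair a b = opair c d ↔ a = c ∧ b = d := by
  constructor
  · intro h
    have hac : a = c := by
      have : upair a a ∈ᵘ opair c d := h ▸ mem_upair.2 (.inl rfl)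
      rcases mem_upair.1 this with h' | h' <;> exact (upair_self_eq h').1.symm
    subst hac
    exact ⟨rfl, upair_inj (upair_inj h)⟩
  · rintro ⟨rfl, rfl⟩
    rfl

instance DFun.upair {f g : (ℕ → M) → M} [hf : DFun f] [hg : DFun g] :
    DFun fun v => upair (f v) (g v) :=
  have := hf.shift 1
  have := hg.shift 1
  DFun.cls (Q := fun v z => z = f v ∨ z = g v)

instance DFun.opair {f g : (ℕ → M) → M} [hf : DFun f] [hg : DFun g] :
    DFun fun v => opair (f v) (g v) := by
  unfold Urelement.opair; infer_instance

theorem Small.prod (x y : M) : Small fun z => ∃ a b, a ∈ᵘ x ∧ b ∈ᵘ y ∧ z = opair a b := by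
  refine (Small.biUnion x (fun a z => ∃ b, b ∈ᵘ y ∧ z = opair a b) fun a _ =>
    Small.image y fun b => opair a b).congr fun z => ?_
  constructor
  · rintro ⟨a, ha, b, hb, h⟩
    exact ⟨a, b, ha, hb, h⟩
  · rintro ⟨a, b, ha, hb, h⟩
    exact ⟨a, ha, b, hb, h⟩

theorem Small.dom (f : M) : Small fun x => ∃ y, opair x y ∈ᵘ f := by
  have h := Small.biUnion f (fun p z => ∃ d, d ∈ᵘ p ∧ z ∈ᵘ d) fun p _ => Small.sUnion p
  exact .of_subset (cls _) fun x ⟨y, hx⟩ => h.mem_cls.2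
    ⟨_, hx, _, mem_upair.2 (.inl rfl), mem_upair.2 (.inl rfl)⟩

theorem Small.of_opair {P : M → Prop} [Dfn fun v => P (v 0)] (x y : M)
    (h : ∀ z, P z → ∃ a b, a ∈ᵘ x ∧ b ∈ᵘ y ∧ z = opair a b) : Small P :=
  .of_subset (cls _) fun z hz => (Small.prod x y).mem_cls.2 (h z hz)

end Comprehension

/-! ### Well-founded recursion inside the model -/

section Recursion

variable {M : Type*} [urLang.Structure M] [hM : Fact (ModelsZFCUR M)]

/-- `f` is an approximation to the function defined on `D` by recursion along `R` with step `G`: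
a set of pairs whose domain is closed under `R`-predecessors and that obeys the recursion. -/
def IsApprox (D : M → Prop) (R : M → M → Prop) (G : M → M → M) (f : M) : Prop :=
  ∀ x y, opair x y ∈ᵘ f → D x ∧ (∀ z, R z x → ∃ y', opair z y' ∈ᵘ f) ∧
    y = G x (cls fun w => w ∈ᵘ f ∧ ∃ z y', R z x ∧ w = opair z y')

/-- At a minimal point of disagreement the two restrictions to predecessors coincide, and hence so
do the values. -/
theorem IsApprox.unique {D : M → Prop} {R : M → M → Prop} {G : M → M → M}
    (hwf : ∀ s, (∃ x, x ∈ᵘ s) → (∀ x, x ∈ᵘ s → D x) → ∃ m, m ∈ᵘ s ∧ ∀ z, z ∈ᵘ s → ¬ R z m)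
    {f f' x y y' : M} (hf : IsApprox D R G f) (hf' : IsApprox D R G f')
    (h : opair x y ∈ᵘ f) (h' : opair x y' ∈ᵘ f') : y = y' := by
  by_contra hne
  obtain ⟨s, -, hs⟩ := Small.of_subset
    (P := fun x => ∃ y y', opair x y ∈ᵘ f ∧ opair x y' ∈ᵘ f' ∧ y ≠ y')
    (cls fun x => ∃ y, opair x y ∈ᵘ f) (fun x ⟨y, _, hx, _⟩ => (Small.dom f).mem_cls.2 ⟨y, hx⟩)
  obtain ⟨m, hm, hmin⟩ := hwf s ⟨x, (hs x).2 ⟨y, y', h, h', hne⟩⟩ fun x hx => by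
    obtain ⟨y, y', hy, -⟩ := (hs x).1 hx
    exact (hf x y hy).1
  obtain ⟨y, y', hy, hy', hne⟩ := (hs m).1 hm
  obtain ⟨-, hp, rfl⟩ := hf m y hy
  obtain ⟨-, hp', rfl⟩ := hf' m y' hy'
  refine hne (congrArg _ (cls_congr fun w => and_congr_left ?_))
  rintro ⟨z, c, hz, rfl⟩
  have key : ∀ c c', opair z c ∈ᵘ f → opair z c' ∈ᵘ f' → c = c' := fun c c' hc hc' => by
    by_contra hcc
    exact hmin z ((hs z).2 ⟨c, c', hc, hc', hcc⟩) hz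
  constructor
  · intro hc
    obtain ⟨c', hc'⟩ := hp' z hz
    rwa [key c c' hc hc']
  · intro hc'
    obtain ⟨c', hc⟩ := hp z hz
    rwa [← key c' c hc hc']

/-- `F` is the union of all approximations. Its domain is all of `D`, since an approximation could
be extended to a minimal missing point. -/
theorem exists_recursion (D : M → Prop) (R : M → M → Prop) (G : M → M → M)
    [hD : Dfn fun v => D (v 0)] [hR : Dfn fun v => R (v 0) (v 1)] [hG : DFun fun v => G (v 0) (v 1)]
    (hcl : ∀ x, D x → ∃ t, x ∈ᵘ t ∧ (∀ y, y ∈ᵘ t → D y) ∧ ∀ y z, y ∈ᵘ t → R z y → z ∈ᵘ t)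
    (hwf : ∀ s, (∃ x, x ∈ᵘ s) → (∀ x, x ∈ᵘ s → D x) → ∃ m, m ∈ᵘ s ∧ ∀ z, z ∈ᵘ s → ¬ R z m) :
    ∃ F : M → M, (DFun fun v => F (v 0)) ∧ ∀ x, D x →
      (Small fun w => ∃ z, R z x ∧ w = opair z (F z)) ∧
      F x = G x (cls fun w => ∃ z, R z x ∧ w = opair z (F z)) := by
  have iR : ∀ (f g : (ℕ → M) → M) [DFun f] [DFun g], Dfn fun v => R (f v) (g v) :=
    fun f g _ _ => Dfn.subst₂ hR inferInstance inferInstance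
  have iD : ∀ (f : (ℕ → M) → M) [DFun f], Dfn fun v => D (f v) :=
    fun f _ => Dfn.subst₁ hD inferInstance
  have iG : ∀ (f g : (ℕ → M) → M) [DFun f] [DFun g], DFun fun v => G (f v) (g v) :=
    fun f g hf hg => ⟨Dfn.subst₃ (R := fun a b c => G a b = c)
      ((hG.out.rename fun n => Nat.casesOn n 2 fun m => Nat.casesOn m 0 fun _ => 1))
      (hf.shift 1) (hg.shift 1) inferInstance⟩
  have iA : Dfn fun v => IsApprox D R G (v 0) := by
    unfold IsApprox
    infer_instance
  have iA : ∀ (f : (ℕ → M) → M) [DFun f], Dfn fun v => IsApprox D R G (f v) :=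
    fun f _ => Dfn.subst₁ iA inferInstance
  let Fr : M → M → Prop := fun x y => ∃ f, IsApprox D R G f ∧ opair x y ∈ᵘ f
  have hu : ∀ {x y y'}, Fr x y → Fr x y' → y = y' := fun ⟨f, hf, h⟩ ⟨f', hf', h'⟩ =>
    hf.unique hwf hf' h h'
  have iFr : ∀ (f g : (ℕ → M) → M) [DFun f] [DFun g], Dfn fun v => Fr (f v) (g v) :=
    fun f g hf hg => Dfn.subst₂ (R := Fr) (by unfold Fr; infer_instance) hf hg
  let F : M → M := fun x => the (Fr x)
  have iF : DFun fun v => F (v 0) := DFun.the (Q := fun v z => Fr (v 0) z)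
  have iF' : ∀ (f : (ℕ → M) → M) [DFun f], DFun fun v => F (f v) :=
    fun f hf => ⟨Dfn.subst₂ (R := fun a b => F a = b)
      (iF.out.rename fun n => Nat.casesOn n 1 fun _ => 0) (hf.shift 1) inferInstance⟩
  have hF : ∀ {x y}, Fr x y → F x = y := fun h => the_eq h fun z hz => hu hz h
  have small : ∀ x, D x → Small fun w => ∃ z, R z x ∧ w = opair z (F z) := fun x hx => by
    obtain ⟨t, hxt, -, ht⟩ := hcl x hx
    obtain ⟨t', -, ht'⟩ := Small.sep t fun z => R z x
    refine (Small.image t' fun z => opair z (F z)).congr fun w => ?_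
    simp only [ht']
    exact ⟨fun ⟨z, hz, h⟩ => ⟨z, hz.2, h⟩, fun ⟨z, hz, h⟩ => ⟨z, ⟨ht x z hxt hz, hz⟩, h⟩⟩
  have step : ∀ {f x y}, IsApprox D R G f → opair x y ∈ᵘ f →
      y = G x (cls fun w => ∃ z, R z x ∧ w = opair z (F z)) := by
    intro f x y hf hxy
    obtain ⟨-, hp, rfl⟩ := hf x y hxy
    refine congrArg _ (cls_congr fun w => ?_)
    constructor
    · rintro ⟨hw, z, y', hz, rfl⟩
      exact ⟨z, hz, by rw [hF ⟨f, hf, hw⟩]⟩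
    · rintro ⟨z, hz, rfl⟩
      obtain ⟨y', hy'⟩ := hp z hz
      rw [hF ⟨f, hf, hy'⟩]
      exact ⟨hy', z, y', hz, rfl⟩
  have total : ∀ x, D x → ∃ y, Fr x y := by
    by_contra hcon
    push Not at hcon
    obtain ⟨x, hx, hxF⟩ := hcon
    obtain ⟨t, hxt, htD, ht⟩ := hcl x hx
    obtain ⟨s, -, hs⟩ := Small.sep t fun x => ∀ y, ¬ Fr x y
    obtain ⟨m, hm, hmin⟩ := hwf s ⟨x, (hs x).2 ⟨hxt, hxF⟩⟩ fun y hy => htD y ((hs y).1 hy).1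
    obtain ⟨hmt, hmF⟩ := (hs m).1 hm
    -- The graph of `F` on `t0`, with the value prescribed at `m` added, is an approximation
    -- containing `m`; this contradicts the choice of `m`.
    obtain ⟨t0, -, ht0⟩ := Small.sep t fun x => ∃ y, Fr x y
    let ym := G m (cls fun w => ∃ z, R z m ∧ w = opair z (F z))
    obtain ⟨f, -, hf⟩ := (Small.image t0 fun z => opair z (F z)).or (.singleton (opair m ym))
    refine hmF ym ⟨f, ?_, (hf _).2 (.inr rfl)⟩
    have pred : ∀ {x z}, x ∈ᵘ t0 ∨ x = m → R z x → z ∈ᵘ t0 := by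
      rintro x z (hx0 | rfl) hz
      · obtain ⟨hxt, y, f, hf, hy⟩ := (ht0 x).1 hx0
        obtain ⟨y', hy'⟩ := (hf x y hy).2.1 z hz
        exact (ht0 z).2 ⟨ht x z hxt hz, y', f, hf, hy'⟩
      · have hzt := ht x z hmt hz
        refine (ht0 z).2 ⟨hzt, ?_⟩
        by_contra hcon
        push Not at hcon
        exact hmin z ((hs z).2 ⟨hzt, hcon⟩) hz
    have memf : ∀ {z}, z ∈ᵘ t0 → opair z (F z) ∈ᵘ f := fun hz => (hf _).2 (.inl ⟨_, hz, rfl⟩)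
    have hm0 : ¬ m ∈ᵘ t0 := fun h => by
      obtain ⟨y, hy⟩ := ((ht0 m).1 h).2
      exact hmF y hy
    have res : ∀ {x}, x ∈ᵘ t0 ∨ x = m →
        (cls fun w => w ∈ᵘ f ∧ ∃ z y', R z x ∧ w = opair z y') =
          cls fun w => ∃ z, R z x ∧ w = opair z (F z) := by
      intro x hx0
      refine cls_congr fun w => ?_
      constructor
      · rintro ⟨hw, z, y', hz, rfl⟩
        rcases (hf _).1 hw with ⟨z', -, hzz⟩ | hzz
        · rw [opair_inj] at hzz
          obtain ⟨rfl, rfl⟩ := hzz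
          exact ⟨z, hz, rfl⟩
        · rw [opair_inj] at hzz
          obtain ⟨rfl, rfl⟩ := hzz
          exact absurd (pred hx0 hz) hm0
      · rintro ⟨z, hz, rfl⟩
        exact ⟨memf (pred hx0 hz), z, _, hz, rfl⟩
    intro x y hxy
    have hx0 : x ∈ᵘ t0 ∨ x = m := by
      rcases (hf _).1 hxy with ⟨z', hz', hzz⟩ | hzz <;> rw [opair_inj] at hzz
      · exact .inl (hzz.1 ▸ hz')
      · exact .inr hzz.1
    refine ⟨?_, fun z hz => ⟨_, memf (pred hx0 hz)⟩, ?_⟩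
    · rcases hx0 with hx0 | rfl
      · exact htD x ((ht0 x).1 hx0).1
      · exact htD x hmt
    · rw [res hx0]
      rcases (hf _).1 hxy with ⟨z', hz', hzz⟩ | hzz <;> rw [opair_inj] at hzz <;>
        obtain ⟨rfl, rfl⟩ := hzz
      · obtain ⟨-, y, f', hf', hy⟩ := (ht0 x).1 hz'
        rw [hF ⟨f', hf', hy⟩]
        exact step hf' hy
      · rfl
  refine ⟨F, iF, fun x hx => ⟨small x hx, ?_⟩⟩
  obtain ⟨y, f, hf, hy⟩ := total x hx
  rw [hF ⟨f, hf, hy⟩]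
  exact step hf hy

end Recursion

/-! ### Transitive sets, induction and canonical names -/

section Foundation

variable {M : Type*} [urLang.Structure M] [hM : Fact (ModelsZFCUR M)]

theorem exists_transitive (v : M) : ∃ t, v ∈ᵘ t ∧ ∀ y z, y ∈ᵘ t → z ∈ᵘ y → z ∈ᵘ t := by
  obtain ⟨s, ⟨e, he, -⟩, hs⟩ := hM.out.zu.infinity
  -- `F n` is {v} together with the members of members of `F m` for m ∈ n. Recursion along ∈
  -- restricted to the inductive set `s` needs no transitive closure, since `s` itself is closed
  -- under the restricted relation.
  obtain ⟨F, hF, h⟩ := exists_recursion (fun x => x ∈ᵘ s) (fun z x => z ∈ᵘ x ∧ z ∈ᵘ s)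
    (fun _ g => cls fun z => z = v ∨ ∃ w, w ∈ᵘ g ∧ ∃ a b, w = opair a b ∧ ∃ c, c ∈ᵘ b ∧ z ∈ᵘ c)
    (fun x hx => ⟨s, hx, fun _ h => h, fun _ _ _ h => h.2⟩)
    (fun s' hne _ => by
      obtain ⟨m, hm, hmin⟩ := hM.out.zu.foundation s' hne
      exact ⟨m, hm, fun z hz hzm => hmin ⟨z, hzm.1, hz⟩⟩)
  have hF' : ∀ x, x ∈ᵘ s → ∀ z, z ∈ᵘ F x ↔
      z = v ∨ ∃ m, (m ∈ᵘ x ∧ m ∈ᵘ s) ∧ ∃ c, c ∈ᵘ F m ∧ z ∈ᵘ c := by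
    intro x hx z
    obtain ⟨hsm, heq⟩ := h x hx
    rw [heq, Small.mem_cls]
    · simp only [hsm.mem_cls]
      refine or_congr_right ⟨?_, ?_⟩
      · rintro ⟨w, ⟨m, hm, rfl⟩, a, b, hab, c, hc, hz⟩
        obtain ⟨rfl, rfl⟩ := opair_inj.1 hab
        exact ⟨m, hm, c, hc, hz⟩
      · rintro ⟨m, hm, c, hc, hz⟩
        exact ⟨_, ⟨m, hm, rfl⟩, m, _, rfl, c, hc, hz⟩
    · refine (Small.singleton v).or (Small.biUnion _
        (fun w z => ∃ a b, w = opair a b ∧ ∃ c, c ∈ᵘ b ∧ z ∈ᵘ c) fun w hw => ?_)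
      obtain ⟨m, -, rfl⟩ := hsm.mem_cls.1 hw
      refine (Small.sUnion (F m)).congr fun z => ?_
      constructor
      · rintro ⟨c, hc, hz⟩
        exact ⟨m, _, rfl, c, hc, hz⟩
      · rintro ⟨a, b, hab, c, hc, hz⟩
        obtain ⟨rfl, rfl⟩ := opair_inj.1 hab
        exact ⟨c, hc, hz⟩
  have hF1 : Dfn fun v => v 1 ∈ᵘ F (v 0) := Dfn.mem (hf := DFun.var) (hg := hF)
  obtain ⟨t, -, ht⟩ := Small.biUnion s (fun n z => z ∈ᵘ F n) fun n _ => Small.mem (F n)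
  refine ⟨t, (ht v).2 ⟨e, he, (hF' e he v).2 (.inl rfl)⟩, fun y z hy hz => ?_⟩
  obtain ⟨n, hn, hy⟩ := (ht y).1 hy
  obtain ⟨k, hk, hnk⟩ := hs n hn
  exact (ht z).2 ⟨k, hk, (hF' k hk z).2 (.inr ⟨n, ⟨(hnk n).2 (.inr rfl), hn⟩, y, hy, hz⟩)⟩

theorem mem_induction {P : M → Prop} [Dfn fun v => P (v 0)]
    (h : ∀ x, (∀ y, y ∈ᵘ x → P y) → P x) (x : M) : P x := by
  by_contra hx
  obtain ⟨t, hxt, ht⟩ := exists_transitive x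
  obtain ⟨s, -, hs⟩ := Small.sep t fun x => ¬ P x
  obtain ⟨m, hm, hmin⟩ := hM.out.zu.foundation s ⟨x, (hs x).2 ⟨hxt, hx⟩⟩
  refine ((hs m).1 hm).2 (h m fun y hy => ?_)
  by_contra hPy
  exact hmin ⟨y, hy, (hs y).2 ⟨ht m y ((hs m).1 hm).1 hy, hPy⟩⟩

/-- Every nonempty set has an element that is minimal for the relation of occurring as the first
coordinate of a pair. -/
theorem exists_pair_minimal (s : M) (hne : ∃ x, x ∈ᵘ s) :
    ∃ m, m ∈ᵘ s ∧ ∀ z r, z ∈ᵘ s → ¬ PairMem z r m := by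
  obtain ⟨x, hx⟩ := hne
  -- `B` adds to `s` the pairs ⟨z, r⟩ with z ∈ `s` that lie in members of `s`, and the singletons
  -- {z}. Such a pair contains {z}, and {z} contains z, so an ∈-minimal element of `B` lies in `s`
  -- and contains no such pair.
  obtain ⟨B, -, hB⟩ : Small fun w => w ∈ᵘ s ∨
      ((∃ m, m ∈ᵘ s ∧ w ∈ᵘ m ∧ ∃ z r, z ∈ᵘ s ∧ w = opair z r) ∨
        ∃ z, z ∈ᵘ s ∧ w = upair z z) := by
    refine (Small.mem s).or (.or ?_ (Small.image s fun z => upair z z))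
    exact Small.biUnion s (fun m w => w ∈ᵘ m ∧ ∃ z r, z ∈ᵘ s ∧ w = opair z r)
      fun m _ => Small.sep m fun w => ∃ z r, z ∈ᵘ s ∧ w = opair z r
  obtain ⟨m, hm, hmin⟩ := hM.out.zu.foundation B ⟨x, (hB x).2 (.inl hx)⟩
  rcases (hB m).1 hm with h | ⟨m', -, -, z, r, hz, rfl⟩ | ⟨z, hz, rfl⟩
  · refine ⟨m, h, fun z r hz hzm => ?_⟩
    rw [pairMem_iff] at hzm
    exact hmin ⟨_, hzm, (hB _).2 (.inr (.inl ⟨m, h, hzm, z, r, hz, rfl⟩))⟩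
  · exact absurd ⟨_, mem_upair.2 (.inl rfl), (hB _).2 (.inr (.inr ⟨z, hz, rfl⟩))⟩ hmin
  · exact absurd ⟨z, mem_upair.2 (.inl rfl), (hB _).2 (.inl hz)⟩ hmin

/-- An urelement v is sent to {⟨v, o⟩}, anything else to the usual canonical name. The cases do not
interfere because urelements have no members. -/
theorem exists_check (o : M) : ∃ F : M → M, (DFun fun v => F (v 0)) ∧ ∀ v, IsSet (F v) ∧
    ∀ w, w ∈ᵘ F v ↔ (Ur v ∧ w = opair v o) ∨ ∃ z, z ∈ᵘ v ∧ w = opair (F z) o := by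
  obtain ⟨F, hF, h⟩ := exists_recursion (fun _ : M => True) (fun z x => z ∈ᵘ x)
    (fun x g => cls fun w => (Ur x ∧ w = opair x o) ∨
      ∃ c, c ∈ᵘ g ∧ ∃ a b, c = opair a b ∧ w = opair b o)
    (fun x _ => by
      obtain ⟨t, h1, h2⟩ := exists_transitive x
      exact ⟨t, h1, fun _ _ => trivial, h2⟩)
    (fun s hne _ => by
      obtain ⟨m, hm, hmin⟩ := hM.out.zu.foundation s hne
      exact ⟨m, hm, fun z hz hzm => hmin ⟨z, hzm, hz⟩⟩)
  refine ⟨F, hF, fun v => ?_⟩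
  obtain ⟨hsm, heq⟩ := h v trivial
  rw [heq]
  refine ⟨isSet_cls _, fun w => ?_⟩
  rw [Small.mem_cls]
  · simp only [hsm.mem_cls]
    refine or_congr_right ⟨?_, ?_⟩
    · rintro ⟨c, ⟨z, hz, rfl⟩, a, b, hab, rfl⟩
      obtain ⟨rfl, rfl⟩ := opair_inj.1 hab
      exact ⟨z, hz, rfl⟩
    · rintro ⟨z, hz, rfl⟩
      exact ⟨_, ⟨z, hz, rfl⟩, z, _, rfl, rfl⟩
  · refine .or (.of_subset (upair (opair v o) (opair v o)) fun z hz => mem_upair.2 (.inl hz.2)) ?_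
    refine Small.biUnion _ (fun c w => ∃ a b, c = opair a b ∧ w = opair b o) fun c hc => ?_
    obtain ⟨z, -, rfl⟩ := hsm.mem_cls.1 hc
    refine (Small.singleton (opair (F z) o)).congr fun w => ⟨fun hw => ⟨z, _, rfl, hw⟩, ?_⟩
    rintro ⟨a, b, hab, rfl⟩
    rw [(opair_inj.1 hab).2]

end Foundation

namespace ForcingPoset

/-! ### Definability of the forcing relation -/

section DefinabilityOfForcing

variable {M : Type*} [urLang.Structure M] (ℙ : ForcingPoset M)

instance dfn_cond {f : (ℕ → M) → M} [hf : DFun f] : Dfn fun v => ℙ.Cond (f v) := by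
  unfold Cond; infer_instance

instance dfn_le {f g : (ℕ → M) → M} [hf : DFun f] [hg : DFun g] :
    Dfn fun v => ℙ.Le (f v) (g v) := by
  unfold Le; infer_instance

instance dfn_incompatible {f g : (ℕ → M) → M} [hf : DFun f] [hg : DFun g] :
    Dfn fun v => ℙ.Incompatible (f v) (g v) :=
  Dfn.subst₂ (R := ℙ.Incompatible) (by unfold Incompatible; infer_instance) hf hg

theorem dfn_denseBelow {D : (ℕ → M) → M → Prop} [hD : Dfn fun v => D (fun n => v (n + 1)) (v 0)]
    {f : (ℕ → M) → M} [hf : DFun f] : Dfn fun v => ℙ.DenseBelow (D v) (f v) := by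
  have : Dfn fun v : ℕ → M => D (fun n => v (n + 1 + 1)) (v 0) :=
    hD.rename fun n => Nat.casesOn n 0 fun m => m + 2
  have := hf.shift 1
  unfold DenseBelow
  infer_instance

instance dfn_nameClause {f g : (ℕ → M) → M} [hf : DFun f] [hg : DFun g] :
    Dfn fun v => ℙ.NameClause (f v) (g v) :=
  Dfn.subst₂ (R := ℙ.NameClause) (by unfold NameClause; infer_instance) hf hg

instance dfn_isName {f : (ℕ → M) → M} [hf : DFun f] : Dfn fun v => ℙ.IsName (f v) :=
  Dfn.subst₁ (R := ℙ.IsName) (by unfold IsName; infer_instance) hf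

instance dfn_forcesUr {f g : (ℕ → M) → M} [hf : DFun f] [hg : DFun g] :
    Dfn fun v => ℙ.ForcesUr (f v) (g v) :=
  Dfn.subst₂ (R := ℙ.ForcesUr) (by unfold ForcesUr DenseBelow; infer_instance) hf hg

instance dfn_forcesUrEq {f g k : (ℕ → M) → M} [hf : DFun f] [hg : DFun g] [hk : DFun k] :
    Dfn fun v => ℙ.ForcesUrEq (f v) (g v) (k v) :=
  Dfn.subst₃ (R := ℙ.ForcesUrEq) (by unfold ForcesUrEq DenseBelow; infer_instance) hf hg hk

instance dfn_isEqTable {f g : (ℕ → M) → M} [hf : DFun f] [hg : DFun g] :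
    Dfn fun v => ℙ.IsEqTable (f v) (g v) :=
  Dfn.subst₂ (R := ℙ.IsEqTable)
    (by
      have : Dfn fun v : ℕ → M =>
          ℙ.EqClause (fun q y z => TripleMem q y z (v 0)) (v 1) (v 2) (v 3) := by
        unfold EqClause SubClause MemClause DenseBelow
        infer_instance
      have : ∀ (f g k l : (ℕ → M) → M) [DFun f] [DFun g] [DFun k] [DFun l],
          Dfn fun v => ℙ.EqClause (fun q y z => TripleMem q y z (f v)) (g v) (k v) (l v) :=
        fun f g k l hf hg hk hl => Dfn.subst₄
          (R := fun e p x y => ℙ.EqClause (fun q v w => TripleMem q v w e) p x y) this hf hg hk hl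
      unfold IsEqTable
      infer_instance) hf hg

instance dfn_forcesEq {f g k : (ℕ → M) → M} [hf : DFun f] [hg : DFun g] [hk : DFun k] :
    Dfn fun v => ℙ.ForcesEq (f v) (g v) (k v) :=
  Dfn.subst₃ (R := ℙ.ForcesEq) (by unfold ForcesEq; infer_instance) hf hg hk

instance dfn_forcesMem {f g k : (ℕ → M) → M} [hf : DFun f] [hg : DFun g] [hk : DFun k] :
    Dfn fun v => ℙ.ForcesMem (f v) (g v) (k v) :=
  Dfn.subst₃ (R := ℙ.ForcesMem) (by unfold ForcesMem MemClause DenseBelow; infer_instance) hf hg hk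

instance dfn_forcesSub {f g k : (ℕ → M) → M} [hf : DFun f] [hg : DFun g] [hk : DFun k] :
    Dfn fun v => ℙ.ForcesSub (f v) (g v) (k v) :=
  Dfn.subst₃ (R := ℙ.ForcesSub)
    (by unfold ForcesSub SubClause MemClause DenseBelow; infer_instance) hf hg hk

theorem dfn_forces {n : ℕ} (φ : ForcingFormula n) {x : Fin n → (ℕ → M) → M}
    (hx : ∀ i, DFun (x i)) {p : (ℕ → M) → M} (hp : DFun p) :
    Dfn fun v => ℙ.Forces φ (fun i => x i v) (p v) := by
  induction φ generalizing p with
  | ur i =>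
    have := hx i
    exact ℙ.dfn_forcesUr
  | urEq i j =>
    have := hx i
    have := hx j
    exact ℙ.dfn_forcesUrEq
  | mem i j =>
    have := hx i
    have := hx j
    exact ℙ.dfn_forcesMem
  | sub i j =>
    have := hx i
    have := hx j
    exact ℙ.dfn_forcesSub
  | eq i j =>
    have := hx i
    have := hx j
    exact ℙ.dfn_forcesEq
  | neg φ ih =>
    have := hp.shift 1
    have := ih (fun i => (hx i).shift 1) (p := fun v => v 0) inferInstance
    unfold Forces
    infer_instance
  | and φ ψ ih₁ ih₂ =>
    have := ih₁ hx hp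
    have := ih₂ hx hp
    unfold Forces
    infer_instance
  | ex φ ih =>
    -- The two shifts account for the witness (index 0) and the condition (index 1). The congruence
    -- after this moves evaluation inside the `Fin.snoc`.
    have h : Dfn fun v : ℕ → M => ℙ.Forces φ
        (fun i => Fin.snoc (α := fun _ => (ℕ → M) → M) (fun i v => x i fun n => v (n + 2))
          (fun v => v 0) i v) (v 1) := by
      refine ih (fun i => ?_) inferInstance
      induction i using Fin.lastCases with
      | last => simpa using (inferInstance : DFun fun v : ℕ → M => v 0)
      | cast i => simpa using (hx i).shift 2
    have h' : Dfn fun v : ℕ → M => ℙ.Forces φ (Fin.snoc (α := fun _ => M)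
        (fun i => x i fun n => v (n + 1 + 1)) (v 0)) (v 1) := by
      refine h.congr fun v =>
        iff_of_eq (congrArg (fun y => ℙ.Forces φ y (v 1)) (funext fun i => ?_))
      induction i using Fin.lastCases with
      | last => simp
      | cast i => simp
    unfold Forces
    exact dfn_denseBelow ℙ (D := fun v q => ∃ z, ℙ.IsName z ∧
      ℙ.Forces φ (Fin.snoc (α := fun _ => M) (fun i => x i v) z) q)

end DefinabilityOfForcing

/-! ### Names and induction on names -/

section Names

variable {M : Type*} [urLang.Structure M] {ℙ : ForcingPoset M}

theorem Le.refl {p : M} (h : ℙ.Cond p) : ℙ.Le p p := ⟨h, h, ℙ.refl p h⟩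

theorem Le.trans {p q r : M} (h : ℙ.Le p q) (h' : ℙ.Le q r) : ℙ.Le p r :=
  ⟨h.1, h'.2.1, ℙ.trans p q r h.1 h.2.1 h'.2.1 h.2.2 h'.2.2⟩

theorem le_one' {p : M} (h : ℙ.Cond p) : ℙ.Le p ℙ.one := ⟨h, ℙ.one_mem, ℙ.le_one p h⟩

theorem NameClause.mono {t t' x : M} (h : ℙ.NameClause t x) (ht : ∀ y, y ∈ᵘ t → y ∈ᵘ t') :
    ℙ.NameClause t' x :=
  ⟨h.1, fun z hz => by
    obtain ⟨y, p, h1, h2, h3⟩ := h.2.1 z hz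
    exact ⟨y, p, h1, h2, h3.imp_left (ht y)⟩, h.2.2⟩

theorem IsName.isSet {x : M} (h : ℙ.IsName x) : IsSet x := by
  obtain ⟨t, hx, ht⟩ := h
  exact (ht x hx).1

theorem IsName.ur_eq {x a y p q r : M} (h : ℙ.IsName x) (ha : Ur a) (hap : PairMem a p x)
    (hyq : PairMem y q x) (h₁ : ℙ.Le r p) (h₂ : ℙ.Le r q) : a = y := by
  obtain ⟨t, hx, ht⟩ := h
  by_contra hne
  exact (ht x hx).2.2 a y p q ha hap hyq hne ⟨r, h₁, h₂⟩

theorem SubClause.congr {E E' : M → M → M → Prop} {p x y : M}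
    (h : ∀ q z w, ℙ.Cond q → ℙ.IsName z → ℙ.IsName w → (∃ r, PairMem z r x) →
      (∃ r, PairMem w r y) → (E q w z ↔ E' q w z)) :
    ℙ.SubClause E p x y ↔ ℙ.SubClause E' p x y := by
  unfold SubClause MemClause DenseBelow
  refine forall_congr' fun z => forall_congr' fun r => forall_congr' fun q =>
    forall_congr' fun hz => forall_congr' fun hzr => forall_congr' fun _ => forall_congr' fun _ =>
    forall_congr' fun q' => forall_congr' fun _ => exists_congr fun q'' =>
    and_congr_right fun hq'' => exists_congr fun w => exists_congr fun s =>
    and_congr_right fun hw => and_congr_right fun hws => and_congr_right fun _ => ?_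
  exact h q'' z w hq''.1 hz hw ⟨r, hzr⟩ ⟨s, hws⟩

theorem EqClause.congr {E E' : M → M → M → Prop} {p x y : M}
    (h : ∀ q z w, ℙ.Cond q → ℙ.IsName z → ℙ.IsName w → (∃ r, PairMem z r x) →
      (∃ r, PairMem w r y) → (E q w z ↔ E' q w z) ∧ (E q z w ↔ E' q z w)) :
    ℙ.EqClause E p x y ↔ ℙ.EqClause E' p x y := by
  unfold EqClause
  rw [SubClause.congr (x := x) fun q z w h₁ h₂ h₃ h₄ h₅ => (h q z w h₁ h₂ h₃ h₄ h₅).1,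
    SubClause.congr (x := y) fun q z w h₁ h₂ h₃ h₄ h₅ => (h q w z h₁ h₃ h₂ h₅ h₄).2]

variable [hM : Fact (ModelsZFCUR M)]

theorem NameClause.of_pairMem {t x y p : M} (h : ℙ.NameClause t x) (hy : PairMem y p x) :
    ℙ.Cond p ∧ (y ∈ᵘ t ∨ Ur y) := by
  rw [pairMem_iff] at hy
  obtain ⟨y', p', h1, h2, h3⟩ := h.2.1 _ hy
  rw [isOPair_iff, opair_inj] at h1
  obtain ⟨rfl, rfl⟩ := h1
  exact ⟨h2, h3⟩

theorem NameClause.mem_of_pairMem {t x y p : M} (h : ℙ.NameClause t x) (hn : ℙ.IsName y)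
    (hy : PairMem y p x) : y ∈ᵘ t :=
  (h.of_pairMem hy).2.resolve_right hn.isSet

theorem exists_nameSet₂ {x y : M} (hx : ℙ.IsName x) (hy : ℙ.IsName y) :
    ∃ t, x ∈ᵘ t ∧ y ∈ᵘ t ∧ ∀ z, z ∈ᵘ t → ℙ.NameClause t z := by
  obtain ⟨t₁, hx, h₁⟩ := hx
  obtain ⟨t₂, hy, h₂⟩ := hy
  obtain ⟨t, -, ht⟩ := (Small.mem t₁).or (Small.mem t₂)
  refine ⟨t, (ht x).2 (.inl hx), (ht y).2 (.inr hy), fun z hz => ?_⟩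
  rcases (ht z).1 hz with hz | hz
  · exact (h₁ z hz).mono fun y hy => (ht y).2 (.inl hy)
  · exact (h₂ z hz).mono fun y hy => (ht y).2 (.inr hy)

/-- A set witnessing that a name is a name also contains the names occurring in it, so a
pair-minimal counterexample can be taken inside that set. -/
theorem name_induction {P : M → Prop} [Dfn fun v => P (v 0)]
    (h : ∀ x, ℙ.IsName x → (∀ y r, ℙ.IsName y → PairMem y r x → P y) → P x) (x : M)
    (hx : ℙ.IsName x) : P x := by
  by_contra hP
  obtain ⟨t, hxt, ht⟩ := hx
  obtain ⟨s, -, hs⟩ := Small.sep t fun x => ¬ P x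
  obtain ⟨m, hm, hmin⟩ := exists_pair_minimal s ⟨x, (hs x).2 ⟨hxt, hP⟩⟩
  obtain ⟨hmt, hmP⟩ := (hs m).1 hm
  refine hmP (h m ⟨t, hmt, ht⟩ fun y r hy hyr => ?_)
  by_contra hy'
  exact hmin y r ((hs y).2 ⟨(ht m hmt).mem_of_pairMem hy hyr, hy'⟩) hyr

end Names

/-! ### The recursion for forced equality -/

section EqTables

variable {M : Type*} [urLang.Structure M] {ℙ : ForcingPoset M} [hM : Fact (ModelsZFCUR M)]

/-- The pair `⟨w, z⟩` is an immediate predecessor of `⟨x, y⟩` in the recursion for `p ⊩ x = y`. -/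
def PairPred (w z x y : M) : Prop :=
  ((∃ r, PairMem z r x) ∧ ∃ r, PairMem w r y) ∨ ((∃ r, PairMem w r x) ∧ ∃ r, PairMem z r y)

/-- Recursion on the pairs from `t`: the value at ⟨x, y⟩ is the set of conditions forcing x = y, and
`e` codes these values as triples. -/
theorem exists_isEqTable (t : M) (ht : ∀ x, x ∈ᵘ t → ℙ.NameClause t x) :
    ∃ e, ℙ.IsEqTable t e := by
  have iP : Dfn fun v : ℕ → M => PairPred (v 0) (v 1) (v 2) (v 3) := by
    unfold PairPred; infer_instance
  have iP : ∀ (f g k l : (ℕ → M) → M) [DFun f] [DFun g] [DFun k] [DFun l],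
      Dfn fun v => PairPred (f v) (g v) (k v) (l v) := fun f g k l hf hg hk hl =>
    iP.subst₄ hf hg hk hl
  let E : M → M → M → M → Prop := fun g q w z => ∃ S, opair (opair w z) S ∈ᵘ g ∧ q ∈ᵘ S
  have iE : ∀ (f g k l : (ℕ → M) → M) [DFun f] [DFun g] [DFun k] [DFun l],
      Dfn fun v => E (f v) (g v) (k v) (l v) := fun f g k l hf hg hk hl =>
    Dfn.subst₄ (by unfold E; infer_instance) hf hg hk hl
  have iG : Dfn fun v : ℕ → M => ℙ.EqClause (E (v 0)) (v 1) (v 2) (v 3) := by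
    unfold EqClause SubClause MemClause DenseBelow
    infer_instance
  have iG : ∀ (f g k l : (ℕ → M) → M) [DFun f] [DFun g] [DFun k] [DFun l],
      Dfn fun v => ℙ.EqClause (E (f v)) (g v) (k v) (l v) := fun f g k l hf hg hk hl =>
    Dfn.subst₄ (R := fun a b c d => ℙ.EqClause (E a) b c d) iG hf hg hk hl
  obtain ⟨F, hF, h⟩ := exists_recursion
    (fun c => ∃ x y, x ∈ᵘ t ∧ y ∈ᵘ t ∧ c = opair x y)
    (fun d c => ∃ w z x y, w ∈ᵘ t ∧ z ∈ᵘ t ∧ d = opair w z ∧ c = opair x y ∧ PairPred w z x y)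
    (fun c g => cls fun p => p ∈ᵘ ℙ.carrier ∧ ∃ x y, c = opair x y ∧ ℙ.EqClause (E g) p x y)
    (fun x hx => by
      obtain ⟨b, -, hb⟩ := Small.prod t t
      refine ⟨b, (hb x).2 hx, fun y => (hb y).1, ?_⟩
      rintro _ _ - ⟨w, z, -, -, hw, hz, rfl, -, -⟩
      exact (hb _).2 ⟨w, z, hw, hz, rfl⟩)
    (fun s hne hs => by
      -- A predecessor of a pair has, in one order or the other, a coordinate occurring in each
      -- coordinate of that pair. So any pair of `s` with a coordinate minimal among all coordinates
      -- is itself minimal.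
      obtain ⟨X, -, hX⟩ := Small.sep t fun x => ∃ y, opair x y ∈ᵘ s ∨ opair y x ∈ᵘ s
      obtain ⟨c, hc⟩ := hne
      obtain ⟨x, y, hx, hy, rfl⟩ := hs c hc
      obtain ⟨m, hm, hmin⟩ := exists_pair_minimal X ⟨x, (hX x).2 ⟨hx, y, .inl hc⟩⟩
      have key : ∀ w z, w ∈ᵘ t → z ∈ᵘ t → opair w z ∈ᵘ s →
          ∀ y, ¬ PairPred w z m y ∧ ¬ PairPred w z y m := by
        intro w z hw hz hwz y
        have h1 : w ∈ᵘ X := (hX w).2 ⟨hw, z, .inl hwz⟩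
        have h2 : z ∈ᵘ X := (hX z).2 ⟨hz, w, .inr hwz⟩
        constructor <;> rintro (⟨⟨r, hr⟩, r', hr'⟩ | ⟨⟨r, hr⟩, r', hr'⟩)
        exacts [hmin z r h2 hr, hmin w r h1 hr, hmin w r' h1 hr', hmin z r' h2 hr']
      obtain ⟨hmt, y, hy | hy⟩ := (hX m).1 hm
      · refine ⟨_, hy, ?_⟩
        rintro _ hwz ⟨w, z, x', y', hw, hz, rfl, hxy, hp⟩
        obtain ⟨rfl, rfl⟩ := opair_inj.1 hxy
        exact (key w z hw hz hwz _).1 hp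
      · refine ⟨_, hy, ?_⟩
        rintro _ hwz ⟨w, z, x', y', hw, hz, rfl, hxy, hp⟩
        obtain ⟨rfl, rfl⟩ := opair_inj.1 hxy
        exact (key w z hw hz hwz _).2 hp)
  have iF : ∀ (f : (ℕ → M) → M) [DFun f], DFun fun v => F (f v) :=
    fun f hf => ⟨Dfn.subst₂ (R := fun a b => F a = b)
      (hF.out.rename fun n => Nat.casesOn n 1 fun _ => 0) (hf.shift 1) inferInstance⟩
  obtain ⟨tt, -, htt⟩ := Small.prod t t
  obtain ⟨e, -, he⟩ := Small.of_opair (P := fun w => ∃ p x y, p ∈ᵘ ℙ.carrier ∧ x ∈ᵘ t ∧ y ∈ᵘ t ∧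
      w = opair p (opair x y) ∧ p ∈ᵘ F (opair x y)) ℙ.carrier tt
    fun w ⟨p, x, y, hp, hx, hy, hw, _⟩ => ⟨p, opair x y, hp, (htt _).2 ⟨x, y, hx, hy, rfl⟩, hw⟩
  have he' : ∀ {p x y}, ℙ.Cond p → x ∈ᵘ t → y ∈ᵘ t →
      (TripleMem p x y e ↔ p ∈ᵘ F (opair x y)) := by
    intro p x y hp hx hy
    rw [tripleMem_iff, he]
    constructor
    · rintro ⟨p', x', y', -, -, -, h, hF⟩
      rw [opair_inj, opair_inj] at h
      obtain ⟨rfl, rfl, rfl⟩ := h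
      exact hF
    · exact fun h => ⟨p, x, y, hp, hx, hy, rfl, h⟩
  have hcl : ∀ {x y r}, x ∈ᵘ t → ℙ.IsName y → PairMem y r x → y ∈ᵘ t := fun hx hy hyr =>
    (ht _ hx).mem_of_pairMem hy hyr
  refine ⟨e, fun x hx => ⟨t, hx, ht⟩, fun x y r => hcl, fun p x y hp hx hy => ?_⟩
  obtain ⟨hsm, heq⟩ := h _ ⟨x, y, hx, hy, rfl⟩
  rw [he' hp hx hy, heq, (Small.sep _ _).mem_cls]
  trans ℙ.EqClause (E (cls fun w => ∃ z, (∃ w z' x' y', w ∈ᵘ t ∧ z' ∈ᵘ t ∧ z = opair w z' ∧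
    opair x y = opair x' y' ∧ PairPred w z' x' y') ∧ w = opair z (F z))) p x y
  · constructor
    · rintro ⟨-, x', y', hxy, h⟩
      obtain ⟨rfl, rfl⟩ := opair_inj.1 hxy
      exact h
    · exact fun h => ⟨hp, x, y, rfl, h⟩
  have key : ∀ q w z, ℙ.Cond q → w ∈ᵘ t → z ∈ᵘ t → PairPred w z x y →
      (E (cls fun w => ∃ z, (∃ w z' x' y', w ∈ᵘ t ∧ z' ∈ᵘ t ∧ z = opair w z' ∧
        opair x y = opair x' y' ∧ PairPred w z' x' y') ∧ w = opair z (F z)) q w z ↔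
        TripleMem q w z e) := by
    intro q w z hq hw hz hp
    rw [he' hq hw hz]
    unfold E
    simp only [hsm.mem_cls]
    constructor
    · rintro ⟨S, ⟨c, -, hc⟩, hq⟩
      obtain ⟨rfl, rfl⟩ := opair_inj.1 hc
      exact hq
    · exact fun h => ⟨_, ⟨_, ⟨w, z, x, y, hw, hz, rfl, rfl, hp⟩, rfl⟩, h⟩
  refine EqClause.congr fun q z w hq hz hw hzx hwy => ?_
  have hzt := hcl hx hz hzx.choose_spec
  have hwt := hcl hy hw hwy.choose_spec
  exact ⟨key q w z hq hwt hzt (.inl ⟨hzx, hwy⟩), key q z w hq hzt hwt (.inr ⟨hzx, hwy⟩)⟩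

/-- Both orders are treated together because the clause for x = y compares elements of x and y in
either order. -/
theorem IsEqTable.agree {t e t' e' : M} (h : ℙ.IsEqTable t e) (h' : ℙ.IsEqTable t' e') (x : M)
    (hx : ℙ.IsName x) : ∀ p y, ℙ.Cond p → x ∈ᵘ t → y ∈ᵘ t → x ∈ᵘ t' → y ∈ᵘ t' →
      (TripleMem p x y e ↔ TripleMem p x y e') ∧ (TripleMem p y x e ↔ TripleMem p y x e') := by
  revert x
  refine name_induction fun x _ ih p y hp hxt hyt hxt' hyt' => ?_
  have key : ∀ q z w, ℙ.Cond q → ℙ.IsName z → ℙ.IsName w → (∃ r, PairMem z r x) →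
      (∃ r, PairMem w r y) → (TripleMem q z w e ↔ TripleMem q z w e') ∧
        (TripleMem q w z e ↔ TripleMem q w z e') := fun q z w hq hz hw ⟨r, hzr⟩ ⟨s, hws⟩ =>
    ih z r hz hzr q w hq (h.2.1 x z r hxt hz hzr) (h.2.1 y w s hyt hw hws)
      (h'.2.1 x z r hxt' hz hzr) (h'.2.1 y w s hyt' hw hws)
  constructor
  · rw [h.2.2 p x y hp hxt hyt, h'.2.2 p x y hp hxt' hyt']
    exact EqClause.congr fun q z w hq hz hw hzx hwy => (key q z w hq hz hw hzx hwy).symm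
  · rw [h.2.2 p y x hp hyt hxt, h'.2.2 p y x hp hyt' hxt']
    exact EqClause.congr fun q w z hq hw hz hwy hzx => key q z w hq hz hw hzx hwy

/-- The recursive clause for `p ⊩ x = y`. -/
theorem forcesEq_iff {p x y : M} (hp : ℙ.Cond p) (hx : ℙ.IsName x) (hy : ℙ.IsName y) :
    ℙ.ForcesEq p x y ↔ ℙ.ForcesSub p x y ∧ ℙ.ForcesSub p y x ∧ ℙ.ForcesUrEq p x y := by
  obtain ⟨t, hxt, hyt, ht⟩ := exists_nameSet₂ hx hy
  obtain ⟨e, he⟩ := exists_isEqTable t ht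
  have key : ∀ q w z, ℙ.Cond q → w ∈ᵘ t → z ∈ᵘ t →
      (ℙ.ForcesEq q w z ↔ TripleMem q w z e) := by
    intro q w z hq hw hz
    constructor
    · rintro ⟨t', e', he', hw', hz', h⟩
      exact (he.agree he' w ⟨t, hw, ht⟩ q z hq hw hz hw' hz').1.2 h
    · exact fun h => ⟨t, e, he, hw, hz, h⟩
  rw [key p x y hp hxt hyt, he.2.2 p x y hp hxt hyt]
  exact EqClause.congr fun q z w hq hz hw ⟨r, hzr⟩ ⟨s, hws⟩ =>
    have hzt := he.2.1 x z r hxt hz hzr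
    have hwt := he.2.1 y w s hyt hw hws
    ⟨(key q w z hq hwt hzt).symm, (key q z w hq hzt hwt).symm⟩

end EqTables

/-! ### Monotonicity, density and substitution for forcing -/

section ForcingTheorems

variable {M : Type*} [urLang.Structure M] {ℙ : ForcingPoset M}

theorem DenseBelow.mono {D : M → Prop} {p q : M} (h : ℙ.DenseBelow D p) (hq : ℙ.Le q p) :
    ℙ.DenseBelow D q := fun r hr => h r (hr.trans hq)

theorem DenseBelow.imp {D D' : M → Prop} {p : M} (h : ℙ.DenseBelow D p)
    (hD : ∀ q, ℙ.Le q p → D q → D' q) : ℙ.DenseBelow D' p := fun r hr => by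
  obtain ⟨s, hs, h⟩ := h r hr
  exact ⟨s, hs, hD s (hs.trans hr) h⟩

theorem DenseBelow.of_denseBelow {D : M → Prop} {p : M}
    (h : ℙ.DenseBelow (fun q => ℙ.DenseBelow D q) p) : ℙ.DenseBelow D p := fun r hr => by
  obtain ⟨s, hs, h⟩ := h r hr
  obtain ⟨s', hs', h⟩ := h s (.refl hs.1)
  exact ⟨s', hs'.trans hs, h⟩

theorem forcesSub_mono {p q x y : M} (h : ℙ.ForcesSub p x y) (hq : ℙ.Le q p) :
    ℙ.ForcesSub q x y := fun z r q' hz hzr hq' => h z r q' hz hzr (hq'.trans hq)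

theorem forcesSub_of_denseBelow {p x y : M} (h : ℙ.DenseBelow (fun q => ℙ.ForcesSub q x y) p) :
    ℙ.ForcesSub p x y := fun z r _ hz hzr hqp hqr =>
  ((h.mono hqp).imp fun q' hq' h' =>
    h' z r q' hz hzr (.refl hq'.1) (hq'.trans hqr)).of_denseBelow

theorem forcesUrEq_symm {p x y : M} (h : ℙ.ForcesUrEq p x y) : ℙ.ForcesUrEq p y x :=
  h.imp fun _ _ => .imp
    (fun ⟨a, r₁, r₂, ha, h₁, h₂, h₁', h₂'⟩ => ⟨a, r₂, r₁, ha, h₂, h₁, h₂', h₁'⟩) And.symm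

theorem forcesUrEq_refl (p x : M) : ℙ.ForcesUrEq p x x := fun q hq => by
  by_cases h : ∃ a r, Ur a ∧ PairMem a r x ∧ ¬ ℙ.Incompatible q r
  · obtain ⟨a, r, ha, har, hqr⟩ := h
    obtain ⟨s, hs, hs'⟩ := not_not.1 hqr
    exact ⟨s, hs, .inl ⟨a, r, r, ha, har, har, hs', hs'⟩⟩
  · push Not at h
    exact ⟨q, .refl hq.1, .inr ⟨h, h⟩⟩

/-- Clause (ii) for the middle name identifies the urelements it shows at compatible conditions. -/
theorem forcesUrEq_trans {p x y z : M} (hy : ℙ.IsName y) (h : ℙ.ForcesUrEq p x y)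
    (h' : ℙ.ForcesUrEq p y z) : ℙ.ForcesUrEq p x z := by
  intro q hq
  obtain ⟨q₁, hq₁, h₁⟩ := h q hq
  obtain ⟨q₂, hq₂, h₂⟩ := h' q₁ (hq₁.trans hq)
  refine ⟨q₂, hq₂.trans hq₁, ?_⟩
  rcases h₁ with ⟨a, r₁, r₂, ha, h₁, h₂', h₃, h₄⟩ | ⟨h₁, h₁'⟩ <;>
    rcases h₂ with ⟨b, s₁, s₂, hb, k₁, k₂, k₃, k₄⟩ | ⟨k₁, k₂⟩
  · obtain rfl := hy.ur_eq ha h₂' k₁ (hq₂.trans h₄) k₃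
    exact .inl ⟨a, r₁, s₂, ha, h₁, k₂, hq₂.trans h₃, k₄⟩
  · exact absurd ⟨q₂, .refl hq₂.1, hq₂.trans h₄⟩ (k₁ a r₂ ha h₂')
  · exact absurd ⟨q₂, hq₂, k₃⟩ (h₁' b s₁ hb k₁)
  · exact .inr ⟨fun a r ha har ⟨s, hs, hs'⟩ => h₁ a r ha har ⟨s, hs.trans hq₂, hs'⟩, k₂⟩

theorem forcesUr_congr {p x y : M} (h : ℙ.ForcesUrEq p x y) (hx : ℙ.ForcesUr p x) :
    ℙ.ForcesUr p y := by
  intro q hq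
  obtain ⟨q₁, hq₁, a, r, ha, har, hr⟩ := hx q hq
  obtain ⟨q₂, hq₂, ⟨b, s₁, s₂, hb, k₁, k₂, k₃, k₄⟩ | ⟨k, -⟩⟩ := h q₁ (hq₁.trans hq)
  · exact ⟨q₂, hq₂.trans hq₁, b, s₂, hb, k₂, k₄⟩
  · exact absurd ⟨q₂, .refl hq₂.1, hq₂.trans hr⟩ (k a r ha har)

theorem isName_snoc {n : ℕ} {x : Fin n → M} {z : M} (hx : ∀ i, ℙ.IsName (x i))
    (hz : ℙ.IsName z) (i : Fin (n + 1)) : ℙ.IsName (Fin.snoc (α := fun _ => M) x z i) := by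
  induction i using Fin.lastCases with
  | last => simpa
  | cast i => simpa using hx i

variable [hM : Fact (ModelsZFCUR M)]

theorem forcesEq_mono {p q x y : M} (hx : ℙ.IsName x) (hy : ℙ.IsName y) (h : ℙ.ForcesEq p x y)
    (hq : ℙ.Le q p) : ℙ.ForcesEq q x y := by
  obtain ⟨h₁, h₂, h₃⟩ := (forcesEq_iff hq.2.1 hx hy).1 h
  exact (forcesEq_iff hq.1 hx hy).2
    ⟨forcesSub_mono h₁ hq, forcesSub_mono h₂ hq, h₃.mono hq⟩

theorem forcesEq_symm {p x y : M} (hp : ℙ.Cond p) (hx : ℙ.IsName x) (hy : ℙ.IsName y)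
    (h : ℙ.ForcesEq p x y) : ℙ.ForcesEq p y x := by
  obtain ⟨h₁, h₂, h₃⟩ := (forcesEq_iff hp hx hy).1 h
  exact (forcesEq_iff hp hy hx).2 ⟨h₂, h₁, forcesUrEq_symm h₃⟩

theorem forcesEq_refl {x : M} (hx : ℙ.IsName x) : ∀ p, ℙ.Cond p → ℙ.ForcesEq p x x := by
  refine name_induction (P := fun x => ∀ p, ℙ.Cond p → ℙ.ForcesEq p x x)
    (fun x hx ih p hp => ?_) x hx
  have hs : ℙ.ForcesSub p x x := fun z r q hz hzr _ hqr q' hq' =>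
    ⟨q', .refl hq'.1, z, r, hz, hzr, hq'.trans hqr, ih z r hz hzr q' hq'.1⟩
  exact (forcesEq_iff hp hx hx).2 ⟨hs, hs, forcesUrEq_refl p x⟩

/-- Induction on the middle name: an element of x is matched with one of z through an element of y,
where the induction hypothesis applies. -/
theorem forcesEq_trans {y : M} (hy : ℙ.IsName y) : ∀ x z p, ℙ.Cond p → ℙ.IsName x → ℙ.IsName z →
    ℙ.ForcesEq p x y → ℙ.ForcesEq p y z → ℙ.ForcesEq p x z := by
  refine name_induction (P := fun y => ∀ x z p, ℙ.Cond p → ℙ.IsName x → ℙ.IsName z →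
    ℙ.ForcesEq p x y → ℙ.ForcesEq p y z → ℙ.ForcesEq p x z) (fun y hy ih => ?_) y hy
  have hsub : ∀ x z p, ℙ.ForcesSub p x y → ℙ.ForcesSub p y z → ℙ.ForcesSub p x z := by
    intro x z p hxy hyz w r q hw hwr hqp hqr q₀ hq₀
    obtain ⟨q₁, hq₁, w₁, r₁, hw₁, hwr₁, hqr₁, he₁⟩ := hxy w r q hw hwr hqp hqr q₀ hq₀
    obtain ⟨q₂, hq₂, w₂, r₂, hw₂, hwr₂, hqr₂, he₂⟩ :=
      hyz w₁ r₁ q₁ hw₁ hwr₁ (hq₁.trans (hq₀.trans hqp)) hqr₁ q₁ (.refl hq₁.1)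
    exact ⟨q₂, hq₂.trans hq₁, w₂, r₂, hw₂, hwr₂, hqr₂,
      ih w₁ r₁ hw₁ hwr₁ w₂ w q₂ hq₂.1 hw₂ hw he₂ (forcesEq_mono hw₁ hw he₁ hq₂)⟩
  intro x z p hp hx hz hxy hyz
  obtain ⟨h₁, h₂, h₃⟩ := (forcesEq_iff hp hx hy).1 hxy
  obtain ⟨k₁, k₂, k₃⟩ := (forcesEq_iff hp hy hz).1 hyz
  exact (forcesEq_iff hp hx hz).2
    ⟨hsub x z p h₁ k₁, hsub z x p k₂ h₂, forcesUrEq_trans hy h₃ k₃⟩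

theorem forcesMem_congr_left {p x x' y : M} (hx : ℙ.IsName x) (hx' : ℙ.IsName x')
    (h : ℙ.ForcesEq p x x') (hxy : ℙ.ForcesMem p x y) : ℙ.ForcesMem p x' y :=
  hxy.imp fun q hq ⟨z, r, hz, hzr, hqr, he⟩ =>
    ⟨z, r, hz, hzr, hqr, forcesEq_trans hx z x' q hq.1 hz hx' he (forcesEq_mono hx hx' h hq)⟩

theorem forcesMem_of_forcesSub {p x y y' : M} (hx : ℙ.IsName x)
    (h : ℙ.ForcesSub p y y') (hxy : ℙ.ForcesMem p x y) : ℙ.ForcesMem p x y' :=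
  (hxy.imp fun q hq ⟨z, r, hz, hzr, hqr, he⟩ =>
    forcesMem_congr_left hz hx he (h z r q hz hzr hq hqr)).of_denseBelow

theorem forcesSub_trans {p x y z : M} (hxy : ℙ.ForcesSub p x y) (hyz : ℙ.ForcesSub p y z) :
    ℙ.ForcesSub p x z := fun w r q hw hwr hqp hqr =>
  forcesMem_of_forcesSub hw (forcesSub_mono hyz hqp) (hxy w r q hw hwr hqp hqr)

theorem forces_mono {n : ℕ} {φ : ForcingFormula n} {x : Fin n → M} {p q : M}
    (hx : ∀ i, ℙ.IsName (x i)) (h : ℙ.Forces φ x p) (hq : ℙ.Le q p) : ℙ.Forces φ x q := by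
  induction φ with
  | ur i => exact DenseBelow.mono h hq
  | urEq i j => exact DenseBelow.mono h hq
  | mem i j => exact DenseBelow.mono h hq
  | sub i j => exact forcesSub_mono h hq
  | eq i j => exact forcesEq_mono (hx i) (hx j) h hq
  | neg φ ih => exact fun ⟨r, hr, hφ⟩ => h ⟨r, hr.trans hq, hφ⟩
  | and φ ψ ih₁ ih₂ => exact ⟨ih₁ hx h.1, ih₂ hx h.2⟩
  | ex φ ih => exact DenseBelow.mono h hq

theorem forces_of_denseBelow {n : ℕ} {φ : ForcingFormula n} {x : Fin n → M} {p : M}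
    (hx : ∀ i, ℙ.IsName (x i)) (hp : ℙ.Cond p) (h : ℙ.DenseBelow (fun q => ℙ.Forces φ x q) p) :
    ℙ.Forces φ x p := by
  induction φ with
  | ur i => exact DenseBelow.of_denseBelow h
  | urEq i j => exact DenseBelow.of_denseBelow h
  | mem i j => exact DenseBelow.of_denseBelow h
  | sub i j => exact forcesSub_of_denseBelow h
  | eq i j =>
    have h' := h.imp fun q hq hφ => (forcesEq_iff hq.1 (hx i) (hx j)).1 hφ
    exact (forcesEq_iff hp (hx i) (hx j)).2
      ⟨forcesSub_of_denseBelow (h'.imp fun _ _ h => h.1),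
        forcesSub_of_denseBelow (h'.imp fun _ _ h => h.2.1),
        (h'.imp fun _ _ h => h.2.2).of_denseBelow⟩
  | neg φ ih =>
    rintro ⟨q, hq, hφ⟩
    obtain ⟨r, hr, hr'⟩ := h q hq
    exact hr' ⟨r, .refl hr.1, forces_mono hx hφ hr⟩
  | and φ ψ ih₁ ih₂ =>
    exact ⟨ih₁ hx (h.imp fun _ _ h => h.1), ih₂ hx (h.imp fun _ _ h => h.2)⟩
  | ex φ ih => exact DenseBelow.of_denseBelow h

/-- Substitution of names that are forced to be equal. -/
theorem forces_congr {n : ℕ} {φ : ForcingFormula n} {x y : Fin n → M} {p : M}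
    (hx : ∀ i, ℙ.IsName (x i)) (hy : ∀ i, ℙ.IsName (y i)) (hp : ℙ.Cond p)
    (hxy : ∀ i, ℙ.ForcesEq p (x i) (y i)) (h : ℙ.Forces φ x p) : ℙ.Forces φ y p := by
  induction φ generalizing p with
  | ur i => exact forcesUr_congr ((forcesEq_iff hp (hx i) (hy i)).1 (hxy i)).2.2 h
  | urEq i j =>
    exact forcesUrEq_trans (hx i) (forcesUrEq_symm ((forcesEq_iff hp (hx i) (hy i)).1 (hxy i)).2.2)
      (forcesUrEq_trans (hx j) h ((forcesEq_iff hp (hx j) (hy j)).1 (hxy j)).2.2)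
  | mem i j =>
    exact forcesMem_congr_left (hx i) (hy i) (hxy i)
      (forcesMem_of_forcesSub (hx i) ((forcesEq_iff hp (hx j) (hy j)).1 (hxy j)).1 h)
  | sub i j =>
    exact forcesSub_trans ((forcesEq_iff hp (hx i) (hy i)).1 (hxy i)).2.1
      (forcesSub_trans h ((forcesEq_iff hp (hx j) (hy j)).1 (hxy j)).1)
  | eq i j =>
    exact forcesEq_trans (hx i) _ _ p hp (hy i) (hy j)
      (forcesEq_symm hp (hx i) (hy i) (hxy i))
      (forcesEq_trans (hx j) _ _ p hp (hx i) (hy j) h (hxy j))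
  | neg φ ih =>
    rintro ⟨q, hq, hφ⟩
    refine h ⟨q, hq, ih hy hx hq.1 (fun i => forcesEq_symm hq.1 (hx i) (hy i)
      (forcesEq_mono (hx i) (hy i) (hxy i) hq)) hφ⟩
  | and φ ψ ih₁ ih₂ => exact ⟨ih₁ hx hy hp hxy h.1, ih₂ hx hy hp hxy h.2⟩
  | ex φ ih =>
    refine DenseBelow.imp h fun q hq ⟨z, hz, hφ⟩ => ⟨z, hz, ih (isName_snoc hx hz)
      (isName_snoc hy hz) hq.1 (fun i => ?_) hφ⟩
    induction i using Fin.lastCases with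
    | last => simpa using forcesEq_refl hz q hq.1
    | cast i => simpa using forcesEq_mono (hx i) (hy i) (hxy i) hq

end ForcingTheorems

/-! ### Mixing names -/

section Mixing

variable {M : Type*} [urLang.Structure M] {ℙ : ForcingPoset M} [hM : Fact (ModelsZFCUR M)]

/-- Read `E r z` as "r selects z". The mixed name consists of the ⟨x, r⟩ such that r selects some z
with ⟨x, s⟩ ∈ z and r ≤ s. Below a condition selecting z no other name contributes. -/
theorem exists_mix (t Z : M) (ht : ∀ x, x ∈ᵘ t → ℙ.NameClause t x) (hZ : ∀ z, z ∈ᵘ Z → z ∈ᵘ t)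
    (E : M → M → Prop) [hE : Dfn fun v => E (v 0) (v 1)]
    (hdown : ∀ r r' z, z ∈ᵘ Z → E r z → ℙ.Le r' r → E r' z)
    (hinc : ∀ r r' z z', z ∈ᵘ Z → z' ∈ᵘ Z → z ≠ z' → E r z → E r' z' → ℙ.Incompatible r r') :
    ∃ y, ℙ.IsName y ∧ ∀ z r, z ∈ᵘ Z → ℙ.Cond r → E r z → ℙ.ForcesEq r y z := by
  have iE : ∀ (f g : (ℕ → M) → M) [DFun f] [DFun g], Dfn fun v => E (f v) (g v) :=
    fun f g hf hg => hE.subst₂ hf hg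
  have hname : ∀ {z}, z ∈ᵘ Z → ℙ.IsName z := fun hz => ⟨t, hZ _ hz, ht⟩
  obtain ⟨X, -, hX⟩ := Small.biUnion Z (fun z x => ∃ s, opair x s ∈ᵘ z) fun z _ => Small.dom z
  obtain ⟨y, hys, hy⟩ := Small.of_opair (P := fun w => ∃ x r z s, w = opair x r ∧ ℙ.Cond r ∧
      z ∈ᵘ Z ∧ E r z ∧ PairMem x s z ∧ ℙ.Le r s) X ℙ.carrier
    fun w ⟨x, r, z, s, hw, hr, hz, _, hx, _⟩ =>
      ⟨x, r, (hX x).2 ⟨z, hz, s, pairMem_iff.1 hx⟩, hr, hw⟩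
  have hy' : ∀ {x r}, PairMem x r y ↔
      ∃ z s, z ∈ᵘ Z ∧ E r z ∧ PairMem x s z ∧ ℙ.Le r s := by
    intro x r
    rw [pairMem_iff, hy]
    constructor
    · rintro ⟨x', r', z, s, h, -, h'⟩
      obtain ⟨rfl, rfl⟩ := opair_inj.1 h
      exact ⟨z, s, h'⟩
    · rintro ⟨z, s, h⟩
      exact ⟨x, r, z, s, rfl, h.2.2.2.1, h⟩
  have same : ∀ {z z' r r' q}, z ∈ᵘ Z → z' ∈ᵘ Z → E r z → E r' z' → ℙ.Le q r → ℙ.Le q r' →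
      z = z' := fun hz hz' hr hr' hq hq' => by
    by_contra hne
    exact hinc _ _ _ _ hz hz' hne hr hr' ⟨_, hq, hq'⟩
  have hyn : ℙ.IsName y := by
    obtain ⟨t', -, ht'⟩ := (Small.mem t).or (Small.singleton y)
    have hsub : ∀ x, x ∈ᵘ t → x ∈ᵘ t' := fun x hx => (ht' x).2 (.inl hx)
    refine ⟨t', (ht' y).2 (.inr rfl), fun x hx => ?_⟩
    rcases (ht' x).1 hx with hx | rfl
    · exact (ht x hx).mono hsub
    · refine ⟨hys, fun w hw => ?_, ?_⟩
      · obtain ⟨c, r, z, s, hw, hr, hz, -, hc, -⟩ := (hy w).1 hw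
        exact ⟨c, r, isOPair_iff.2 hw, hr, ((ht z (hZ z hz)).of_pairMem hc).2.imp_left (hsub c)⟩
      -- Compatible conditions select the same z, so clause (ii) is inherited from z.
      · rintro a c p q ha hap hcq hne ⟨r, hrp, hrq⟩
        obtain ⟨z, s, hz, hpz, haz, hps⟩ := hy'.1 hap
        obtain ⟨z', s', hz', hqz, hcz, hqs⟩ := hy'.1 hcq
        obtain rfl := same hz hz' hpz hqz hrp hrq
        exact hne ((hname hz).ur_eq ha haz hcz (hrp.trans hps) (hrq.trans hqs))
  refine ⟨y, hyn, fun z r hz hr hrz => (forcesEq_iff hr hyn (hname hz)).2 ⟨?_, ?_, ?_⟩⟩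
  · intro x s q hx hxs hqr hqs q' hq'
    obtain ⟨z', s', hz', hsz', hxz', hss'⟩ := hy'.1 hxs
    obtain rfl := same hz' hz hsz' hrz hqs hqr
    exact ⟨q', .refl hq'.1, x, s', hx, hxz', hq'.trans (hqs.trans hss'),
      forcesEq_refl hx q' hq'.1⟩
  · intro x s q hx hxs hqr hqs q' hq'
    have hq'r := hq'.trans hqr
    exact ⟨q', .refl hq'.1, x, q', hx,
      hy'.2 ⟨z, s, hz, hdown r q' z hz hrz hq'r, hxs, hq'.trans hqs⟩,
      .refl hq'.1, forcesEq_refl hx q' hq'.1⟩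
  · intro q hq
    by_cases h : ∃ a s, Ur a ∧ PairMem a s z ∧ ¬ ℙ.Incompatible q s
    · obtain ⟨a, s, ha, has, hqs⟩ := h
      obtain ⟨q', hq', hq's⟩ := not_not.1 hqs
      exact ⟨q', hq', .inl ⟨a, q', s, ha, hy'.2 ⟨z, s, hz, hdown r q' z hz hrz (hq'.trans hq), has,
        hq's⟩, has, .refl hq'.1, hq's⟩⟩
    · push Not at h
      refine ⟨q, .refl hq.1, .inr ⟨fun a s ha has ⟨q', hq', hq's⟩ => ?_, h⟩⟩
      obtain ⟨z', s', hz', hsz', haz', hss'⟩ := hy'.1 has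
      obtain rfl := same hz' hz hsz' hrz hq's (hq'.trans hq)
      exact h a s' ha haz' ⟨q', hq', hq's.trans hss'⟩

end Mixing

end ForcingPoset

/-! ### Collection implies Fullness -/

section Fullness

variable {M : Type*} [urLang.Structure M] [hM : Fact (ModelsZFCUR M)]

omit hM in
theorem Collection.exists (hC : Collection M) (w : M) (R : M → M → Prop)
    [Dfn fun v => R (v 0) (v 1)] (h : ∀ x, x ∈ᵘ w → ∃ y, R x y) :
    ∃ v, ∀ x, x ∈ᵘ w → ∃ y, y ∈ᵘ v ∧ R x y := by
  obtain ⟨n, φ, u, hφ⟩ := Dfn.formula (fun v : ℕ → M => R (v 0) (v 1)) 2 w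
  have hφ' : ∀ x y, φ.Realize (Sum.elim u ![x, y]) ↔ R x y := fun x y => hφ _
  obtain ⟨v, hv⟩ := hC n φ u w fun x hx => by simpa only [hφ'] using h x hx
  exact ⟨v, fun x hx => by simpa only [hφ'] using hv x hx⟩

open ForcingPoset in
theorem Collection.fullnessPrinciple (hC : Collection M) : FullnessPrinciple M := by
  intro ℙ n φ x p hx hp hex
  have dF : ∀ (f g : (ℕ → M) → M) [DFun f] [DFun g],
      Dfn fun v => ℙ.Forces φ (Fin.snoc (α := fun _ => M) x (f v)) (g v) := by
    intro f g hf hg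
    have := ℙ.dfn_forces φ (x := Fin.snoc (α := fun _ => (ℕ → M) → M) (fun i _ => x i) f)
      (fun i => by
        induction i using Fin.lastCases with
        | last => simpa
        | cast i => simpa using DFun.const) hg
    refine this.congr fun v =>
      iff_of_eq (congrArg (fun y => ℙ.Forces φ y (g v)) (funext fun i => ?_))
    induction i using Fin.lastCases with
    | last => simp
    | cast i => simp
  let Φ : M → M → Prop := fun z q => ℙ.Forces φ (Fin.snoc (α := fun _ => M) x z) q
  have dΦ : ∀ (f g : (ℕ → M) → M) [DFun f] [DFun g], Dfn fun v => Φ (f v) (g v) := dF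
  have hΦ : ∀ {z q r}, ℙ.IsName z → Φ z q → ℙ.Le r q → Φ z r := fun hz =>
    forces_mono (isName_snoc hx hz)
  obtain ⟨D, -, hD⟩ := Small.sep ℙ.carrier fun q => ∃ z, ℙ.IsName z ∧ Φ z q
  -- What is collected are sets T certifying namehood rather than bare names, so that the union of
  -- the certificates certifies itself. Members of `v` that are not certificates are discarded in
  -- forming `Z`.
  obtain ⟨v, hv⟩ := hC.exists D
    (fun q T => (∃ z, z ∈ᵘ T ∧ Φ z q) ∧ ∀ y, y ∈ᵘ T → ℙ.NameClause T y) fun q hq => by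
      obtain ⟨-, z, ⟨T, hz, hT⟩, hzq⟩ := (hD q).1 hq
      exact ⟨T, ⟨z, hz, hzq⟩, hT⟩
  obtain ⟨Z, hZs, hZ⟩ := Small.biUnion v (fun T z => z ∈ᵘ T ∧ ∀ y, y ∈ᵘ T → ℙ.NameClause T y)
    fun T _ => Small.sep T fun _ => ∀ y, y ∈ᵘ T → ℙ.NameClause T y
  have hZc : ∀ z, z ∈ᵘ Z → ℙ.NameClause Z z := by
    intro z hz
    obtain ⟨T, hTv, hzT, hT⟩ := (hZ z).1 hz
    exact (hT z hzT).mono fun y hy => (hZ y).2 ⟨T, hTv, hy, hT⟩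
  have hZn : ∀ {z}, z ∈ᵘ Z → ℙ.IsName z := fun hz => ⟨Z, hz, hZc⟩
  obtain ⟨o, hirr, htr, htot, hmin⟩ := hM.out.ac Z hZs
  obtain ⟨y, hy, hyZ⟩ := exists_mix Z Z hZc (fun _ h => h)
    (fun r z => Φ z r ∧ ∀ z', z' ∈ᵘ Z → PairMem z' z o → ¬ ∃ r', ℙ.Le r' r ∧ Φ z' r')
    (fun r r' z hz ⟨h, h'⟩ hr => ⟨hΦ (hZn hz) h hr,
      fun z' hz' hzz ⟨s, hs, hs'⟩ => h' z' hz' hzz ⟨s, hs.trans hr, hs'⟩⟩)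
    (fun r r' z z' hz hz' hne h h' ⟨s, hs, hs'⟩ => by
      rcases (htot z z' hz hz').resolve_left hne with hlt | hlt
      · exact h'.2 z hz hlt ⟨s, hs', hΦ (hZn hz) h.1 hs⟩
      · exact h.2 z' hz' hlt ⟨s, hs, hΦ (hZn hz') h'.1 hs'⟩)
  refine ⟨y, hy, forces_of_denseBelow (isName_snoc hx hy) hp fun q hq => ?_⟩
  -- The first name `m` in `Z` that works somewhere below q is selected by any r ≤ q forcing φ(m);
  -- thus selecting conditions are dense.
  obtain ⟨S, -, hS⟩ := Small.sep Z fun z => ∃ r, ℙ.Le r q ∧ Φ z r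
  obtain ⟨m, hm, hmS⟩ := hmin S (fun a ha => ((hS a).1 ha).1) (by
    obtain ⟨r, hr, z, hz, hzr⟩ := hex q hq
    obtain ⟨T, hT, ⟨z', hz', hΦ'⟩, hTn⟩ := hv r ((hD r).2 ⟨hr.1, z, hz, hzr⟩)
    exact ⟨z', (hS z').2 ⟨(hZ z').2 ⟨T, hT, hz', hTn⟩, r, hr, hΦ'⟩⟩)
  obtain ⟨hmZ, r, hr, hmr⟩ := (hS m).1 hm
  refine ⟨r, hr, ?_⟩
  have he : ℙ.ForcesEq r y m := hyZ m r hmZ hr.1 ⟨hmr, fun z hz hzm ⟨r', hr', hzr'⟩ => by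
    by_cases hne : z = m
    · subst hne
      exact hirr z hz hzm
    · exact hirr m hmZ (htr m z m hmZ hz hmZ
        (hmS z ((hS z).2 ⟨hz, r', hr'.trans hr, hzr'⟩) hne) hzm)⟩
  refine forces_congr (isName_snoc hx (hZn hmZ)) (isName_snoc hx hy) hr.1 (fun i => ?_) hmr
  induction i using Fin.lastCases with
  | last => simpa using forcesEq_symm hr.1 hy (hZn hmZ) he
  | cast i => simpa using forcesEq_refl (hx i) r hr.1

end Fullness

namespace ForcingPoset

/-! ### Canonical names -/

section Check

variable {M : Type*} [urLang.Structure M] (ℙ : ForcingPoset M) [hM : Fact (ModelsZFCUR M)]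

/-- The canonical name of an element of `M`. -/
noncomputable def check : M → M := (exists_check ℙ.one).choose

instance dfun_check {f : (ℕ → M) → M} [hf : DFun f] : DFun fun v => ℙ.check (f v) :=
  have h : Dfn fun v : ℕ → M => ℙ.check (v 1) = v 0 := (exists_check ℙ.one).choose_spec.1.out
  ⟨Dfn.subst₂ (R := fun a b => ℙ.check a = b) (h.rename fun n => Nat.casesOn n 1 fun _ => 0)
    (hf.shift 1) inferInstance⟩

theorem isSet_check (v : M) : IsSet (ℙ.check v) := ((exists_check ℙ.one).choose_spec.2 v).1

theorem mem_check {v w : M} : w ∈ᵘ ℙ.check v ↔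
    (Ur v ∧ w = opair v ℙ.one) ∨ ∃ z, z ∈ᵘ v ∧ w = opair (ℙ.check z) ℙ.one :=
  ((exists_check ℙ.one).choose_spec.2 v).2 w

theorem pairMem_check {v y r : M} : PairMem y r (ℙ.check v) ↔
    r = ℙ.one ∧ ((Ur v ∧ y = v) ∨ ∃ z, z ∈ᵘ v ∧ y = ℙ.check z) := by
  rw [pairMem_iff, mem_check]
  simp only [opair_inj]
  constructor
  · rintro (⟨h, rfl, rfl⟩ | ⟨z, hz, rfl, rfl⟩)
    · exact ⟨rfl, .inl ⟨h, rfl⟩⟩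
    · exact ⟨rfl, .inr ⟨z, hz, rfl⟩⟩
  · rintro ⟨rfl, ⟨h, rfl⟩ | ⟨z, hz, rfl⟩⟩
    · exact .inl ⟨h, rfl, rfl⟩
    · exact .inr ⟨z, hz, rfl, rfl⟩

theorem ur_pairMem_check {v a r : M} : (Ur a ∧ PairMem a r (ℙ.check v)) ↔
    Ur v ∧ a = v ∧ r = ℙ.one := by
  rw [pairMem_check]
  constructor
  · rintro ⟨ha, rfl, ⟨hv, rfl⟩ | ⟨z, -, rfl⟩⟩
    · exact ⟨hv, rfl, rfl⟩
    · exact absurd ha (ℙ.isSet_check z)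
  · rintro ⟨hv, rfl, rfl⟩
    exact ⟨hv, rfl, .inl ⟨hv, rfl⟩⟩

theorem name_pairMem_check {v z r : M} (hz : ℙ.IsName z) : PairMem z r (ℙ.check v) ↔
    r = ℙ.one ∧ ∃ c, c ∈ᵘ v ∧ z = ℙ.check c := by
  rw [pairMem_check]
  refine and_congr_right fun _ => or_iff_right ?_
  rintro ⟨h, rfl⟩
  exact hz.isSet h

theorem nameClause_check {t v : M} (h : ∀ z, z ∈ᵘ v → ℙ.check z ∈ᵘ t) :
    ℙ.NameClause t (ℙ.check v) := by
  refine ⟨ℙ.isSet_check v, fun w hw => ?_, fun a y p q ha hap hyq hne => ?_⟩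
  · rcases ℙ.mem_check.1 hw with ⟨hv, rfl⟩ | ⟨z, hz, rfl⟩
    · exact ⟨v, ℙ.one, isOPair_iff.2 rfl, ℙ.one_mem, .inr hv⟩
    · exact ⟨_, ℙ.one, isOPair_iff.2 rfl, ℙ.one_mem, .inl (h z hz)⟩
  · obtain ⟨hv, rfl, -⟩ := ℙ.ur_pairMem_check.1 ⟨ha, hap⟩
    obtain ⟨-, ⟨-, rfl⟩ | ⟨z, hz, -⟩⟩ := ℙ.pairMem_check.1 hyq
    · exact absurd rfl hne
    · exact absurd hv (IsSet.of_mem hz)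

/-- The canonical names of the members of a transitive set certify one another. -/
theorem exists_nameSet_check (w : M) : ∃ t, (∀ x, x ∈ᵘ t → ℙ.NameClause t x) ∧
    ℙ.check w ∈ᵘ t ∧ ∀ z, z ∈ᵘ w → ℙ.check z ∈ᵘ t := by
  obtain ⟨T, hwT, hT⟩ := exists_transitive w
  obtain ⟨t, -, ht⟩ := Small.image T fun z => ℙ.check z
  refine ⟨t, fun x hx => ?_, (ht _).2 ⟨w, hwT, rfl⟩, fun z hz => (ht _).2 ⟨z, hT w z hwT hz, rfl⟩⟩
  obtain ⟨v, hv, rfl⟩ := (ht x).1 hx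
  exact ℙ.nameClause_check fun z hz => (ht _).2 ⟨z, hT v z hv hz, rfl⟩

theorem isName_check (v : M) : ℙ.IsName (ℙ.check v) := by
  obtain ⟨t, ht, hv, -⟩ := ℙ.exists_nameSet_check v
  exact ⟨t, hv, ht⟩

end Check

/-! ### Forcing at a minimal condition -/

section Atoms

variable {M : Type*} [urLang.Structure M] {ℙ : ForcingPoset M}

variable (ℙ) in
/-- `x` is a minimal condition. -/
def IsAtomCond (x : M) : Prop := ℙ.Cond x ∧ ∀ q, ℙ.Le q x → q = x

/-- This collapses every density clause, so forcing at a minimal condition obeys the classical truth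
clauses. -/
theorem IsAtomCond.denseBelow_iff {x : M} (hx : ℙ.IsAtomCond x) {D : M → Prop} :
    ℙ.DenseBelow D x ↔ D x := by
  constructor
  · intro h
    obtain ⟨r, hr, hD⟩ := h x (.refl hx.1)
    exact hx.2 r hr ▸ hD
  · intro h q hq
    obtain rfl := hx.2 q hq
    exact ⟨q, hq, h⟩

theorem IsAtomCond.incompatible_iff {x r : M} (hx : ℙ.IsAtomCond x) :
    ℙ.Incompatible x r ↔ ¬ ℙ.Le x r := by
  refine not_congr ⟨?_, fun h => ⟨x, .refl hx.1, h⟩⟩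
  rintro ⟨s, hs, hsr⟩
  exact hx.2 s hs ▸ hsr

theorem IsAtomCond.forcesSub_iff {x y z : M} (hx : ℙ.IsAtomCond x) :
    ℙ.ForcesSub x y z ↔
      ∀ c r, ℙ.IsName c → PairMem c r y → ℙ.Le x r → ℙ.ForcesMem x c z := by
  constructor
  · exact fun h c r hc hcr hxr => h c r x hc hcr (.refl hx.1) hxr
  · intro h c r q hc hcr hq hqr
    obtain rfl := hx.2 q hq
    exact h c r hc hcr hqr

variable [hM : Fact (ModelsZFCUR M)]

theorem IsAtomCond.forcesUr_check {x v : M} (hx : ℙ.IsAtomCond x) :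
    ℙ.ForcesUr x (ℙ.check v) ↔ Ur v := by
  rw [ForcesUr, hx.denseBelow_iff]
  constructor
  · rintro ⟨a, r, ha, har, -⟩
    exact (ℙ.ur_pairMem_check.1 ⟨ha, har⟩).1
  · exact fun hv => ⟨v, ℙ.one, hv, ℙ.pairMem_check.2 ⟨rfl, .inl ⟨hv, rfl⟩⟩, le_one' hx.1⟩

theorem IsAtomCond.forcesMem_check_right {x y v : M} (hx : ℙ.IsAtomCond x) :
    ℙ.ForcesMem x y (ℙ.check v) ↔ ∃ z, z ∈ᵘ v ∧ ℙ.ForcesEq x (ℙ.check z) y := by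
  rw [ForcesMem, MemClause, hx.denseBelow_iff]
  constructor
  · rintro ⟨c, r, hc, hcr, -, he⟩
    obtain ⟨-, z, hz, rfl⟩ := (ℙ.name_pairMem_check hc).1 hcr
    exact ⟨z, hz, he⟩
  · rintro ⟨z, hz, he⟩
    exact ⟨_, ℙ.one, ℙ.isName_check z, ℙ.pairMem_check.2 ⟨rfl, .inr ⟨z, hz, rfl⟩⟩,
      le_one' hx.1, he⟩

theorem IsAtomCond.forcesSub_check_left {x y v : M} (hx : ℙ.IsAtomCond x) :
    ℙ.ForcesSub x (ℙ.check v) y ↔ ∀ z, z ∈ᵘ v → ℙ.ForcesMem x (ℙ.check z) y := by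
  rw [hx.forcesSub_iff]
  constructor
  · exact fun h z hz => h _ ℙ.one (ℙ.isName_check z)
      (ℙ.pairMem_check.2 ⟨rfl, .inr ⟨z, hz, rfl⟩⟩) (le_one' hx.1)
  · intro h c r hc hcr _
    obtain ⟨-, z, hz, rfl⟩ := (ℙ.name_pairMem_check hc).1 hcr
    exact h z hz

/-- Induction on membership. Urelements are recognised by the =^𝒜 part, sets by Extensionality. -/
theorem IsAtomCond.forcesEq_check {x : M} (hx : ℙ.IsAtomCond x) {v u : M} :
    ℙ.ForcesEq x (ℙ.check v) (ℙ.check u) ↔ v = u := by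
  refine ⟨?_, fun h => h ▸ forcesEq_refl (ℙ.isName_check v) x hx.1⟩
  refine mem_induction (P := fun v => ∀ u, ℙ.ForcesEq x (ℙ.check v) (ℙ.check u) → v = u)
    (fun v ih u h => ?_) v u
  obtain ⟨h₁, h₂, h₃⟩ := (forcesEq_iff hx.1 (ℙ.isName_check v) (ℙ.isName_check u)).1 h
  rw [hx.forcesSub_check_left] at h₁ h₂
  have hur : Ur v ∨ Ur u → v = u := by
    intro hvu
    rw [ForcesUrEq, hx.denseBelow_iff] at h₃
    rcases h₃ with ⟨a, r₁, r₂, ha, hv, hu, -⟩ | ⟨hv, hu⟩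
    · exact (ℙ.ur_pairMem_check.1 ⟨ha, hv⟩).2.1.symm.trans (ℙ.ur_pairMem_check.1 ⟨ha, hu⟩).2.1
    · rcases hvu with h | h
      · exact absurd (le_one' hx.1) (hx.incompatible_iff.1 (hv v ℙ.one h
          (ℙ.pairMem_check.2 ⟨rfl, .inl ⟨h, rfl⟩⟩)))
      · exact absurd (le_one' hx.1) (hx.incompatible_iff.1 (hu u ℙ.one h
          (ℙ.pairMem_check.2 ⟨rfl, .inl ⟨h, rfl⟩⟩)))
  by_cases hv : Ur v
  · exact hur (.inl hv)
  by_cases hu : Ur u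
  · exact hur (.inr hu)
  refine IsSet.ext hv hu fun z => ⟨fun hz => ?_, fun hz => ?_⟩
  · obtain ⟨c, hc, he⟩ := hx.forcesMem_check_right.1 (h₁ z hz)
    rwa [ih z hz c (forcesEq_symm hx.1 (ℙ.isName_check c) (ℙ.isName_check z) he)]
  · obtain ⟨c, hc, he⟩ := hx.forcesMem_check_right.1 (h₂ z hz)
    rwa [← ih c hc z he]

theorem IsAtomCond.forcesMem_check {x v u : M} (hx : ℙ.IsAtomCond x) :
    ℙ.ForcesMem x (ℙ.check v) (ℙ.check u) ↔ v ∈ᵘ u := by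
  simp only [hx.forcesMem_check_right, hx.forcesEq_check]
  exact ⟨fun ⟨z, hz, h⟩ => h ▸ hz, fun h => ⟨v, h, rfl⟩⟩

theorem IsAtomCond.value_unique {x y v u : M} (hx : ℙ.IsAtomCond x) (hy : ℙ.IsName y)
    (hv : ℙ.ForcesEq x y (ℙ.check v)) (hu : ℙ.ForcesEq x y (ℙ.check u)) : v = u :=
  hx.forcesEq_check.1 (forcesEq_trans hy _ _ x hx.1 (ℙ.isName_check v) (ℙ.isName_check u)
    (forcesEq_symm hx.1 hy (ℙ.isName_check v) hv) hu)

/-- A minimal condition decides the value of every name. -/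
theorem IsAtomCond.exists_value {x : M} (hx : ℙ.IsAtomCond x) (y : M) (hy : ℙ.IsName y) :
    ∃ v, ℙ.ForcesEq x y (ℙ.check v) := by
  refine name_induction (P := fun y => ∃ v, ℙ.ForcesEq x y (ℙ.check v)) (fun y hy ih => ?_) y hy
  -- An urelement shown by `y` at a condition above x is the value. Otherwise the value is the set
  -- of values of the names that `y` shows above x, which is a set by Replacement.
  by_cases hur : ∃ a r, Ur a ∧ PairMem a r y ∧ ℙ.Le x r
  · obtain ⟨a, r, ha, har, hxr⟩ := hur
    refine ⟨a, (forcesEq_iff hx.1 hy (ℙ.isName_check a)).2 ⟨?_, ?_, ?_⟩⟩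
    · rw [hx.forcesSub_iff]
      intro c s hc hcs hxs
      obtain rfl := hy.ur_eq ha har hcs hxr hxs
      exact absurd ha hc.isSet
    · rw [hx.forcesSub_check_left]
      exact fun z hz => absurd ha (IsSet.of_mem hz)
    · rw [ForcesUrEq, hx.denseBelow_iff]
      exact .inl ⟨a, r, ℙ.one, ha, har, ℙ.pairMem_check.2 ⟨rfl, .inl ⟨ha, rfl⟩⟩, hxr, le_one' hx.1⟩
  · obtain ⟨d, -, hd⟩ := Small.dom y
    obtain ⟨v, hvs, hv⟩ := Small.image_rel d
      (fun z v => ℙ.IsName z ∧ (∃ r, PairMem z r y ∧ ℙ.Le x r) ∧ ℙ.ForcesEq x z (ℙ.check v))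
      fun z _ v u h h' => hx.value_unique h.1 h.2.2 h'.2.2
    refine ⟨v, (forcesEq_iff hx.1 hy (ℙ.isName_check v)).2 ⟨?_, ?_, ?_⟩⟩
    · rw [hx.forcesSub_iff]
      intro c s hc hcs hxs
      obtain ⟨u, hu⟩ := ih c s hc hcs
      exact hx.forcesMem_check_right.2 ⟨u, (hv u).2 ⟨c, (hd c).2 ⟨s, pairMem_iff.1 hcs⟩, hc,
        ⟨s, hcs, hxs⟩, hu⟩, forcesEq_symm hx.1 hc (ℙ.isName_check u) hu⟩
    · rw [hx.forcesSub_check_left]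
      intro u hu
      obtain ⟨c, -, hc, ⟨s, hcs, hxs⟩, he⟩ := (hv u).1 hu
      rw [ForcesMem, MemClause, hx.denseBelow_iff]
      exact ⟨c, s, hc, hcs, hxs, he⟩
    · rw [ForcesUrEq, hx.denseBelow_iff]
      refine .inr ⟨fun a r ha har => hx.incompatible_iff.2 fun h => hur ⟨a, r, ha, har, h⟩,
        fun a r ha har => absurd (ℙ.ur_pairMem_check.1 ⟨ha, har⟩).1 hvs⟩

end Atoms

end ForcingPoset

/-! ### Truth in the model as forcing at a minimal condition -/

section Translation

/-- The variable of the forcing language that corresponds to a term. -/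
def termIndex {m k : ℕ} : urLang.Term (Fin m ⊕ Fin k) → Fin (m + k)
  | .var i => finSumFinEquiv i
  | .func f _ => Empty.elim f

/-- The atomic formula of the forcing language for a symbol of urelement set theory. -/
def relForcing {n : ℕ} : {l : ℕ} → UrRel l → (Fin l → Fin n) → ForcingFormula n
  | _, .ur, i => .ur (i 0)
  | _, .mem, i => .mem (i 0) (i 1)

/-- The formula of the forcing language with the same meaning. -/
def toForcing {m : ℕ} : {k : ℕ} → urLang.BoundedFormula (Fin m) k → ForcingFormula (m + k)
  -- There may be no free variable available, so the contradiction uses a bound one.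
  | _, .falsum => .ex (.and (.ur (Fin.last _)) (.neg (.ur (Fin.last _))))
  | _, .equal t₁ t₂ => .eq (termIndex t₁) (termIndex t₂)
  | _, .rel R ts => relForcing R fun i => termIndex (ts i)
  | _, .imp φ ψ => .neg (.and (toForcing φ) (.neg (toForcing ψ)))
  | k, .all φ => .neg (.ex (n := m + k) (.neg (toForcing (m := m) (k := k + 1) φ)))

variable {M : Type*} [urLang.Structure M] {ℙ : ForcingPoset M} [hM : Fact (ModelsZFCUR M)]

omit hM in
theorem append_termIndex {m k : ℕ} (v : Fin m → M) (xs : Fin k → M)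
    (t : urLang.Term (Fin m ⊕ Fin k)) :
    Fin.append v xs (termIndex t) = t.realize (Sum.elim v xs) := by
  match t with
  | .var (.inl i) => simp [termIndex]
  | .var (.inr i) => simp [termIndex]
  | .func f _ => exact Empty.elim f

-- The only non-formal case is the quantifier: each name equals a canonical one at x, so quantifying
-- over names amounts to quantifying over M.
open ForcingPoset in
theorem forces_toForcing {x : M} (hx : ℙ.IsAtomCond x) {m k : ℕ}
    (φ : urLang.BoundedFormula (Fin m) k) (v : Fin m → M) (xs : Fin k → M) :
    ℙ.Forces (toForcing φ) (fun i => ℙ.check (Fin.append v xs i)) x ↔ φ.Realize v xs := by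
  have hneg : ∀ {n} {ψ : ForcingFormula n} {y : Fin n → M},
      ℙ.Forces (.neg ψ) y x ↔ ¬ ℙ.Forces ψ y x := fun {n ψ y} =>
    not_congr ⟨fun ⟨q, hq, h⟩ => hx.2 q hq ▸ h, fun h => ⟨x, .refl hx.1, h⟩⟩
  have hand : ∀ {n} {ψ χ : ForcingFormula n} {y : Fin n → M},
      ℙ.Forces (.and ψ χ) y x ↔ ℙ.Forces ψ y x ∧ ℙ.Forces χ y x := Iff.rfl
  have hex : ∀ {n} {ψ : ForcingFormula (n + 1)} {y : Fin n → M}, ℙ.Forces (.ex ψ) y x ↔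
      ∃ z, ℙ.IsName z ∧ ℙ.Forces ψ (Fin.snoc (α := fun _ => M) y z) x := hx.denseBelow_iff
  induction φ with
  | falsum =>
    simp only [toForcing, hex, hand, hneg]
    exact iff_of_false (fun ⟨z, _, h, h'⟩ => h' h) id
  | equal t₁ t₂ =>
    simp only [toForcing, Forces, hx.forcesEq_check, append_termIndex]
    rfl
  | @rel k l R ts =>
    change ℙ.Forces (relForcing (show UrRel l from R) fun i => termIndex (ts i)) _ x ↔
      Structure.RelMap R fun i => (ts i).realize (Sum.elim v xs)
    simp only [← append_termIndex]
    change UrRel l at R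
    cases R with
    | ur =>
      refine hx.forcesUr_check.trans (iff_of_eq (congrArg _ (funext fun i => ?_)))
      fin_cases i; rfl
    | mem =>
      refine hx.forcesMem_check.trans (iff_of_eq (congrArg _ (funext fun i => ?_)))
      fin_cases i <;> rfl
  | imp φ ψ ih₁ ih₂ =>
    simp only [toForcing, hneg, hand, ih₁, ih₂, BoundedFormula.realize_imp, not_and, not_not]
  | all φ ih =>
    have hs : ∀ d, (fun i => ℙ.check (Fin.append v (Fin.snoc (α := fun _ => M) xs d) i)) =
        Fin.snoc (α := fun _ => M) (fun i => ℙ.check (Fin.append v xs i)) (ℙ.check d) := by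
      intro d
      rw [Fin.append_snoc]
      funext i
      induction i using Fin.lastCases with
      | last => simp
      | cast i => simp
    simp only [toForcing, hneg, hex, BoundedFormula.realize_all, ← ih, hs]
    push Not
    refine ⟨fun h d => h _ (ℙ.isName_check d), fun h z hz => ?_⟩
    have hn := fun i => ℙ.isName_check (Fin.append v xs i)
    obtain ⟨d, hd⟩ := hx.exists_value z hz
    refine forces_congr (isName_snoc hn (ℙ.isName_check d)) (isName_snoc hn hz) hx.1
      (fun i => ?_) (h d)
    induction i using Fin.lastCases with
    | last => simpa using forcesEq_symm hx.1 hz (ℙ.isName_check d) hd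
    | cast i => simpa using forcesEq_refl (hn i) x hx.1

end Translation

/-! ### Fullness implies Collection -/

section FlatPoset

variable {M : Type*} [urLang.Structure M] [hM : Fact (ModelsZFCUR M)]

theorem not_mem_self (w : M) : ¬ w ∈ᵘ w := fun h => by
  obtain ⟨z, hz, hmin⟩ := hM.out.zu.foundation (upair w w) ⟨w, mem_upair.2 (.inl rfl)⟩
  obtain rfl : z = w := by simpa [mem_upair] using hz
  exact hmin ⟨z, h, mem_upair.2 (.inl rfl)⟩

/-- The forcing poset whose conditions are the members of `w`, which are pairwise incomparable, and
the largest element `w`. -/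
theorem exists_flatPoset (w : M) : ∃ ℙ : ForcingPoset M, ℙ.one = w ∧
    (∀ x, x ∈ᵘ w → ℙ.IsAtomCond x) ∧ ∀ q, ℙ.Cond q → q ∈ᵘ w ∨ q = w := by
  obtain ⟨P, -, hP⟩ := (Small.mem w).or (Small.singleton w)
  obtain ⟨R, -, hR⟩ := Small.of_opair
    (P := fun z => ∃ p q, p ∈ᵘ P ∧ q ∈ᵘ P ∧ z = opair p q ∧ (p = q ∨ q = w)) P P
    fun z ⟨p, q, hp, hq, hz, _⟩ => ⟨p, q, hp, hq, hz⟩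
  have hR' : ∀ {p q}, PairMem p q R ↔ p ∈ᵘ P ∧ q ∈ᵘ P ∧ (p = q ∨ q = w) := by
    intro p q
    rw [pairMem_iff, hR]
    constructor
    · rintro ⟨p', q', hp, hq, h, h'⟩
      obtain ⟨rfl, rfl⟩ := opair_inj.1 h
      exact ⟨hp, hq, h'⟩
    · exact fun ⟨hp, hq, h⟩ => ⟨p, q, hp, hq, rfl, h⟩
  have hw : w ∈ᵘ P := (hP w).2 (.inr rfl)
  refine ⟨{
    carrier := P
    rel := R
    one := w
    rel_sub := fun z hz => ?_
    refl := fun p hp => hR'.2 ⟨hp, hp, .inl rfl⟩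
    antisymm := fun p q hp hq h h' => ?_
    trans := fun p q r hp hq hr h h' => ?_
    one_mem := hw
    le_one := fun p hp => hR'.2 ⟨hp, hw, .inr rfl⟩ }, rfl, fun x hx => ⟨(hP x).2 (.inl hx), ?_⟩,
    fun q hq => (hP q).1 hq⟩
  · obtain ⟨p, q, hp, hq, hz, -⟩ := (hR z).1 hz
    exact ⟨p, q, hp, hq, isOPair_iff.2 hz⟩
  · rcases (hR'.1 h).2.2 with h | rfl
    · exact h
    · rcases (hR'.1 h').2.2 with h' | h'
      · exact h'.symm
      · exact h'
  · rcases (hR'.1 h).2.2 with rfl | rfl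
    · exact h'
    · rcases (hR'.1 h').2.2 with rfl | rfl
      · exact h
      · exact hR'.2 ⟨hp, hr, .inr rfl⟩
  · rintro q ⟨-, -, h⟩
    rcases (hR'.1 h).2.2 with h | rfl
    · exact h
    · exact absurd hx (not_mem_self x)

open ForcingPoset in
theorem FullnessPrinciple.collection (hF : FullnessPrinciple M) : Collection M := by
  intro n φ u w h
  -- For empty w the top would itself be minimal, with no member of w below it; that case is
  -- trivial.
  by_cases hw : ∃ x, x ∈ᵘ w
  swap
  · exact ⟨w, fun x hx => absurd ⟨x, hx⟩ hw⟩
  obtain ⟨x₀, hx₀⟩ := hw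
  -- From here on `ℙ.one` is both the top condition and the set w of minimal conditions.
  obtain ⟨ℙ, rfl, hatom, hcond⟩ := exists_flatPoset w
  have hone : ∀ {x}, x ∈ᵘ ℙ.one → ℙ.Le x ℙ.one := fun hx => le_one' (hatom _ hx).1
  -- a name for the generic element of `w`
  obtain ⟨X, hX, hXe⟩ : ∃ X, ℙ.IsName X ∧ ∀ x, x ∈ᵘ ℙ.one → ℙ.ForcesEq x X (ℙ.check x) := by
    obtain ⟨t, ht, -, hwt⟩ := ℙ.exists_nameSet_check ℙ.one
    obtain ⟨Z, -, hZ⟩ := Small.image ℙ.one fun x => ℙ.check x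
    obtain ⟨X, hX, hXe⟩ := exists_mix t Z ht
      (fun z hz => by
        obtain ⟨x, hx, rfl⟩ := (hZ z).1 hz
        exact hwt x hx)
      (fun r z => r ∈ᵘ ℙ.one ∧ z = ℙ.check r)
      (fun r r' z _ hr hr' => (hatom r hr.1).2 r' hr' ▸ hr)
      (fun r r' z z' _ _ hne hr hr' ⟨s, hs, hs'⟩ => by
        obtain rfl := (hatom r hr.1).2 s hs
        obtain rfl := (hatom r' hr'.1).2 s hs'
        exact hne (hr.2.trans hr'.2.symm))
    exact ⟨X, hX, fun x hx => hXe _ x ((hZ _).2 ⟨x, hx, rfl⟩) (hatom x hx).1 ⟨hx, rfl⟩⟩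
  -- The renumbering lists the parameters, then x, then y, so that `ForcingFormula.ex` binds y.
  let ψ : urLang.BoundedFormula (Fin (n + 2)) 0 := φ.relabel finSumFinEquiv
  let χ : ForcingFormula (n + 2) := toForcing (m := n + 2) (k := 0) ψ
  have hψ : ∀ {a x y}, ℙ.IsAtomCond a → (ℙ.Forces χ
      (fun i => ℙ.check (Fin.append u ![x, y] i)) a ↔ φ.Realize (Sum.elim u ![x, y])) := by
    intro a x y ha
    rw [← (forces_toForcing ha ψ (Fin.append u ![x, y]) Fin.elim0).trans (c := φ.Realize _)]
    · rw [Fin.append_elim0]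
      rfl
    · refine (Formula.realize_relabel (φ := φ) (g := finSumFinEquiv)).trans
        (iff_of_eq (congrArg _ ?_))
      funext i
      rcases i with i | i <;> simp
  let us : Fin (n + 1) → M := Fin.snoc (α := fun _ => M) (fun i => ℙ.check (u i)) X
  have hus : ∀ i, ℙ.IsName (us i) := isName_snoc (fun i => ℙ.isName_check _) hX
  have heq : ∀ {a z y}, a ∈ᵘ ℙ.one → ℙ.ForcesEq a z (ℙ.check y) →
      ∀ i : Fin (n + 2), ℙ.ForcesEq a (Fin.snoc (α := fun _ => M) us z i)
        (ℙ.check (Fin.append u ![a, y] i)) := by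
    intro a z y ha he i
    have hc := (hatom a ha).1
    refine Fin.addCases (m := n) (n := 2) (fun i => ?_) (fun i => ?_) i
    · rw [Fin.append_left]
      change ℙ.ForcesEq a (Fin.snoc (α := fun _ => M) us z i.castSucc.castSucc) _
      rw [Fin.snoc_castSucc]
      unfold us
      rw [Fin.snoc_castSucc]
      exact forcesEq_refl (ℙ.isName_check _) a hc
    · rw [Fin.append_right]
      fin_cases i
      · change ℙ.ForcesEq a (Fin.snoc (α := fun _ => M) us z (Fin.last n).castSucc) (ℙ.check a)
        rw [Fin.snoc_castSucc]
        unfold us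
        rw [Fin.snoc_last]
        exact hXe a ha
      · change ℙ.ForcesEq a (Fin.snoc (α := fun _ => M) us z (Fin.last (n + 1))) (ℙ.check y)
        rwa [Fin.snoc_last]
  -- Below every condition lies some r ∈ w. There X equals the canonical name of r, and the
  -- canonical name of any y with φ(r, y) is a witness.
  obtain ⟨y, hy, hfy⟩ := hF ℙ (n + 1) χ us ℙ.one hus ℙ.one_mem (by
    intro q hq
    obtain ⟨r, hr, hrw⟩ : ∃ r, ℙ.Le r q ∧ r ∈ᵘ ℙ.one := by
      rcases hcond q hq.1 with hq' | rfl
      · exact ⟨q, .refl hq.1, hq'⟩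
      · exact ⟨x₀, hone hx₀, hx₀⟩
    obtain ⟨y, hy⟩ := h r hrw
    have hz := ℙ.isName_check y
    have he := heq hrw (forcesEq_refl hz r hr.1)
    exact ⟨r, hr, _, hz, forces_congr (fun i => ℙ.isName_check _) (isName_snoc hus hz) hr.1
      (fun i => forcesEq_symm hr.1 (isName_snoc hus hz i) (ℙ.isName_check _) (he i))
      ((hψ (hatom r hrw)).2 hy)⟩)
  -- The collecting set consists of the values of the single name `y` at the members of w.
  obtain ⟨v, -, hv⟩ := Small.image_rel ℙ.one (fun x v => ℙ.ForcesEq x y (ℙ.check v))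
    fun x hx _ _ => (hatom x hx).value_unique hy
  refine ⟨v, fun x hx => ?_⟩
  obtain ⟨b, hb⟩ := (hatom x hx).exists_value y hy
  refine ⟨b, (hv b).2 ⟨x, hx, hb⟩, (hψ (hatom x hx)).1 ?_⟩
  exact forces_congr (isName_snoc hus hy) (fun i => ℙ.isName_check _) (hatom x hx).1
    (heq hx hb) (forces_mono (isName_snoc hus hy) hfy (hone hx))

end FlatPoset

end Urelement

theorem mainTheorem3 {M : Type*} [Urelement.urLang.Structure M]
    (hM : Urelement.ModelsZFCUR M) :
    Urelement.Collection M ↔ Urelement.FullnessPrinciple M :=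
  have : Fact (Urelement.ModelsZFCUR M) := ⟨hM⟩
  ⟨Urelement.Collection.fullnessPrinciple, Urelement.FullnessPrinciple.collection⟩
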